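/- Let $n\ge 3$. A rational $n$-marked tropical curve $C$ is a finite tree with positive edge lengths and $n$ ends labelled $1,\dots,n$ attached to its vertices, such that every vertex has valence (edges plus ends) at least $3$; curves are considered up to isomorphism. Its root is the vertex carrying end $1$, and its vertices are weakly ordered by their distance from the root. The radially aligned combinatorial type of $C$ is its tree with labelled ends together with this weak ordering; one type is a face of another if it arises from it by contracting edges and weakening the ordering accordingly. Let $M_{0,n}^{\mathrm{rad}}$ be the set of isomorphism classes of curves, mapped to $Q_n=\mathbb R^{\binom n2}/\{(x_i+x_j)_{i<j}: x\in\mathbb R^n\}$ by $d(C)=(\operatorname{dist}(i,j))_{i<j}$. To a type assign the cone in $Q_n$ of the vectors $(\operatorname{dist}(i,j))_{i<j}$ of all nonnegative edge lengths on its tree for which the distances from the root respect the weak ordering (non-strictly). Let $K_{n-1}$ be the complete graph on $\{2,\dots,n\}$ with edge set $E$ and cycle matroid $M$, let $L=\mathbb R(1,\dots,1)\subset\mathbb R^{E}$, and let $B'(K_{n-1})=B/L\subset\mathbb R^E/L$, where $B$ is the set of $w\in\mathbb R^E$ such that every $e\in E$ lies in a base of $M$ of minimal $w$-weight. For $F\subseteq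 E$ put $\rho_F=-\sum_{e\in F}v_e$, where $v_e$ are the standard basis vectors. To a chain of flats $\emptyset\subsetneq F_1\subsetneq\dots\subsetneq F_r\subsetneq E$ of $M$ assign the cone in $\mathbb R^E/L$ spanned by the classes of $\rho_{F_1},\dots,\rho_{F_r}$. Then the cones of the radially aligned types form a polyhedral fan in $Q_n$, the cones of the chains of flats form a polyhedral fan in $\mathbb R^E/L$ with support $B'(K_{n-1})$, and these agree as follows. There are a bijection $\Psi$ from the chains of flats of $K_{n-1}$ to the radially aligned combinatorial types and a linear isomorphism $\Lambda:Q_n\to\mathbb R^E/L$ such that: 1. $\Psi^{-1}$ sends the type of a curve $C$ to the chain consisting of the following flats, one for each distance $t>0$ from the root to a vertex of $C$: delete all vertices at distance less than $t$ from the root, with their ends and edges, and take the disjoint union of the complete graphs on the sets of ends of the remaining connected components. 2. Inclusion of chains corresponds under $\Psi$ to the face relation of types, and $d(C)$ lies in the cone of the type of $C'$ if and only if the type of $C$ is a face of the type of $C'$. 3. For $I\subsetneq\{2,\dots,n\}$ with $|I|\ge2$, $\Lambda$ sends the vector of the curve with a single edge, of length $1$, that separates the ends in $I$ from the others to the class of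 $\rho_F$, where $F$ is the edge set of the complete graph on $I$. 4. $C\mapsto\Lambda(d(C))$ is a bijection from $M_{0,n}^{\mathrm{rad}}$ onto $B'(K_{n-1})$. 5. $\Lambda$ maps the cone of the type $\Psi(\mathcal F)$ onto the cone of $\mathcal F$, for every chain of flats $\mathcal F$; in particular it maps the fan of radially aligned types onto the fan of chains of flats, so that $M_{0,n}^{\mathrm{rad}}=B'(K_{n-1})$ as polyhedral cone complexes and as fans. -/

import Mathlib

/-! ### The cycle matroid of a finite graph -/

namespace CycleMatroid

open SimpleGraph

/-- The mod 2 incidence vector of an edge. -/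
noncomputable def inc {V : Type*} (e : Sym2 V) : V →₀ ZMod 2 :=
  Sym2.lift ⟨fun u v => Finsupp.single u 1 + Finsupp.single v 1, fun _ _ => add_comm _ _⟩ e

theorem inc_mk {V : Type*} (u v : V) :
    inc s(u, v) = Finsupp.single u 1 + Finsupp.single v 1 := rfl

theorem inc_mem_span {V : Type*} {I : Set (Sym2 V)} {u v : V}
    (h : (fromEdgeSet I).Reachable u v) :
    inc s(u, v) ∈ Submodule.span (ZMod 2) (inc '' I) := by
  obtain ⟨p⟩ := h
  induction p with
  | nil =>
    rw [inc_mk, ← Finsupp.single_add, CharTwo.add_self_eq_zero, Finsupp.single_zero]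
    exact Submodule.zero_mem _
  | @cons a b c hab p ih =>
    rw [fromEdgeSet_adj] at hab
    have h1 : inc s(a, b) ∈ Submodule.span (ZMod 2) (inc '' I) :=
      Submodule.subset_span ⟨_, hab.1, rfl⟩
    have h2 := Submodule.add_mem _ h1 ih
    have h3 : inc s(a, b) + inc s(b, c) = inc s(a, c) := by
      simp only [inc_mk]
      have : (Finsupp.single b (1 : ZMod 2)) + Finsupp.single b 1 = 0 := by
        rw [← Finsupp.single_add, CharTwo.add_self_eq_zero, Finsupp.single_zero]
      calc _ = Finsupp.single a (1 : ZMod 2) + (Finsupp.single b 1 + Finsupp.single b 1)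
            + Finsupp.single c 1 := by abel
        _ = _ := by rw [this, add_zero]
    rwa [h3] at h2

theorem inc_notMem_span {V : Type*} {I : Set (Sym2 V)} {u v : V}
    (h : ¬ (fromEdgeSet I).Reachable u v) :
    inc s(u, v) ∉ Submodule.span (ZMod 2) (inc '' I) := by
  classical
  intro hmem
  let f : (V →₀ ZMod 2) →ₗ[ZMod 2] ZMod 2 :=
    Finsupp.linearCombination (ZMod 2)
      (fun x => if (fromEdgeSet I).Reachable u x then (1 : ZMod 2) else 0)
  have hf : ∀ x y, f (inc s(x, y)) =
      (if (fromEdgeSet I).Reachable u x then (1 : ZMod 2) else 0) +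
      (if (fromEdgeSet I).Reachable u y then (1 : ZMod 2) else 0) := by
    intro x y
    simp [f, inc_mk, Finsupp.linearCombination_single]
  have hle : Submodule.span (ZMod 2) (inc '' I) ≤ LinearMap.ker f := by
    rw [Submodule.span_le]
    rintro _ ⟨e, he, rfl⟩
    induction e with
    | _ x y =>
      simp only [SetLike.mem_coe, LinearMap.mem_ker, hf]
      have hxy : (fromEdgeSet I).Reachable x y := by
        by_cases hne : x = y
        · subst hne; exact Reachable.refl _
        · exact Adj.reachable ((fromEdgeSet_adj I).2 ⟨he, hne⟩)
      have : (fromEdgeSet I).Reachable u x ↔ (fromEdgeSet I).Reachable u y :=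
        ⟨fun k => k.trans hxy, fun k => k.trans hxy.symm⟩
      simp only [this]
      exact CharTwo.add_self_eq_zero _
  have := hle hmem
  rw [LinearMap.mem_ker, hf, if_pos (Reachable.refl _), if_neg h] at this
  simp at this

theorem linearIndepOn_inc {V : Type*} [Finite V] {I : Set (Sym2 V)}
    (hd : ∀ e ∈ I, ¬ e.IsDiag) (hI : (fromEdgeSet I).IsAcyclic) :
    LinearIndepOn (ZMod 2) inc I := by
  have hfin : I.Finite := Set.toFinite I
  induction I, hfin using Set.Finite.induction_on with
  | empty => exact linearIndepOn_empty _ _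
  | @insert e I he _ ih =>
    have hac : (fromEdgeSet I).IsAcyclic :=
      hI.anti (fromEdgeSet_mono (Set.subset_insert _ _))
    refine (linearIndepOn_insert he).2 ⟨ih (fun x hx => hd x (Set.mem_insert_of_mem _ hx)) hac, ?_⟩
    have hde := hd e (Set.mem_insert _ _)
    induction e with
    | _ u v =>
      have hne : u ≠ v := by simpa using hde
      apply inc_notMem_span
      have hadj : (fromEdgeSet (insert s(u, v) I)).Adj u v :=
        (fromEdgeSet_adj _).2 ⟨Set.mem_insert _ _, hne⟩
      have hb := isAcyclic_iff_forall_adj_isBridge.1 hI hadj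
      rw [isBridge_iff] at hb
      intro hr
      refine hb (hr.mono ?_)
      intro x y hxy
      rw [fromEdgeSet_adj] at hxy
      rw [deleteEdges_adj, fromEdgeSet_adj]
      refine ⟨⟨Set.mem_insert_of_mem _ hxy.1, hxy.2⟩, ?_⟩
      intro h
      rw [Set.mem_singleton_iff] at h
      exact he (h ▸ hxy.1)

end CycleMatroid

/-- The cycle matroid of a finite graph: the ground set is the edge set, the independent sets are
the (edge sets of) forests. -/
noncomputable def cycleMatroid {V : Type*} [Finite V] (G : SimpleGraph V) : Matroid (Sym2 V) :=
  (IndepMatroid.ofFinite (E := G.edgeSet) (Set.toFinite _)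
    (fun I => I ⊆ G.edgeSet ∧ (SimpleGraph.fromEdgeSet I).IsAcyclic)
    ⟨Set.empty_subset _, by simp⟩
    (fun _ _ hJ hIJ => ⟨hIJ.trans hJ.1, hJ.2.anti (SimpleGraph.fromEdgeSet_mono hIJ)⟩)
    (by
      intro I J hI hJ hlt
      by_contra hcon
      have hdiag : ∀ e ∈ J, ¬ e.IsDiag := fun e he => G.not_isDiag_of_mem_edgeSet (hJ.1 he)
      have hlin := CycleMatroid.linearIndepOn_inc hdiag hJ.2
      have hsub : CycleMatroid.inc '' J ⊆
          Submodule.span (ZMod 2) (CycleMatroid.inc '' I) := by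
        rintro _ ⟨e, he, rfl⟩
        by_cases heI : e ∈ I
        · exact Submodule.subset_span ⟨e, heI, rfl⟩
        induction e with
        | _ u v =>
          apply CycleMatroid.inc_mem_span
          by_contra hr
          refine hcon ⟨s(u, v), he, heI, Set.insert_subset (hJ.1 he) hI.1, ?_⟩
          have := hI.2.sup_edge_of_not_reachable hr
          refine this.anti ?_
          intro x y hxy
          rw [SimpleGraph.fromEdgeSet_adj] at hxy
          rw [SimpleGraph.sup_adj, SimpleGraph.fromEdgeSet_adj, SimpleGraph.edge_adj]
          rcases hxy with ⟨h1 | h1, h2⟩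
          · right
            refine ⟨?_, h2⟩
            rw [Sym2.eq_iff] at h1
            tauto
          · exact Or.inl ⟨h1, h2⟩
      have hfin : Fintype (CycleMatroid.inc '' I) := Fintype.ofFinite _
      have hle := linearIndependent_le_span' (fun x : J => CycleMatroid.inc (x : Sym2 V)) hlin
        (CycleMatroid.inc '' I) (by
          rintro _ ⟨x, rfl⟩
          exact hsub ⟨x, x.2, rfl⟩)
      have h2 : (CycleMatroid.inc '' I).ncard ≤ I.ncard := Set.ncard_image_le (Set.toFinite I)
      have h3 : J.ncard ≤ (CycleMatroid.inc '' I).ncard := by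
        rw [← Nat.card_coe_set_eq, ← Nat.card_coe_set_eq, Nat.card_eq_fintype_card (α := _ '' I)]
        have : Finite J := Set.toFinite J
        have h4 := hle
        rw [← Nat.cast_card (α := J)] at h4
        exact_mod_cast h4
      omega)
    (fun _ h => h.1)).matroid

theorem cycleMatroid_E {V : Type*} [Finite V] (G : SimpleGraph V) :
    (cycleMatroid G).E = G.edgeSet := rfl

theorem cycleMatroid_indep_iff {V : Type*} [Finite V] (G : SimpleGraph V) (I : Set (Sym2 V)) :
    (cycleMatroid G).Indep I ↔ I ⊆ G.edgeSet ∧ (SimpleGraph.fromEdgeSet I).IsAcyclic :=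
  Iff.rfl

/-! ### Polyhedral fans -/

/-- A polyhedral fan in a real vector space: a nonempty finite collection of polyhedral cones that
contains every face of each of its cones and in which any two cones meet in a common face. -/
structure IsPolyhedralFan {W : Type*} [AddCommGroup W] [Module ℝ W]
    (X : Set (PointedCone ℝ W)) : Prop where
  nonempty : X.Nonempty
  finite : X.Finite
  polyhedral : ∀ σ ∈ X, σ.FG
  face_mem : ∀ σ ∈ X, ∀ τ : PointedCone ℝ W, τ.IsFaceOf σ → τ ∈ X
  inter_face : ∀ σ ∈ X, ∀ τ ∈ X, (σ ⊓ τ).IsFaceOf σ ∧ (σ ⊓ τ).IsFaceOf τ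

/-! ### The Bergman fan of a matroid, modulo lineality -/

namespace Matroid

variable {α : Type*}

/-- The Bergman fan `B(M)` as a set: the weights `w` for which `M_w`, the matroid whose bases are
the bases of `M` of minimal `w`-weight, has no loop, i.e. each element lies in such a base. -/
def bergmanSet (M : Matroid α) : Set (M.E → ℝ) :=
  {w | ∀ e ∈ M.E, ∃ B, M.IsBase B ∧ e ∈ B ∧ ∀ B', M.IsBase B' →
    ∑ᶠ x : {x : M.E // (x : α) ∈ B}, w x.1 ≤ ∑ᶠ x : {x : M.E // (x : α) ∈ B'}, w x.1}

/-- The line `L` spanned by `(1, …, 1)`. -/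
def lineality (M : Matroid α) : Submodule ℝ (M.E → ℝ) := Submodule.span ℝ {fun _ => 1}

/-- The ambient space `ℝ^E / L` of `B'(M) = B(M) / L`. -/
abbrev BergmanSpace (M : Matroid α) : Type _ := (M.E → ℝ) ⧸ M.lineality

/-- The set `B'(M) = B(M) / L`. -/
def bergmanSet' (M : Matroid α) : Set M.BergmanSpace := M.lineality.mkQ '' M.bergmanSet

/-- Chains of flats `∅ ⊊ F₁ ⊊ ⋯ ⊊ F_r ⊊ E`, given as the set of their members `F₁, …, F_r`. -/
def ChainOfFlats (M : Matroid α) : Type _ :=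
  {S : Set (Set α) // IsChain (· ⊆ ·) S ∧ ∀ F ∈ S, M.IsFlat F ∧ F.Nonempty ∧ F ≠ M.E}

/-- The vector `ρ_F = -∑_{e ∈ F} v_e`, modulo `L`. -/
noncomputable def flatRay (M : Matroid α) (F : Set α) : M.BergmanSpace :=
  M.lineality.mkQ (-({x : M.E | (x : α) ∈ F}.indicator 1))

/-- The cone (modulo `L`) of a chain of flats. -/
noncomputable def flatCone (M : Matroid α) (S : M.ChainOfFlats) : PointedCone ℝ M.BergmanSpace :=
  PointedCone.hull ℝ (M.flatRay '' S.1)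

/-- The fan `B'(M)`, with its chains-of-flats subdivision. -/
def bergmanFan (M : Matroid α) : Set (PointedCone ℝ M.BergmanSpace) := Set.range M.flatCone

end Matroid

/-! ### Rational tropical curves with `n` marked ends

The marks are `Fin n`, with `0` in the place of the first mark. -/

/-- A rational `n`-marked (stable) abstract tropical curve: a finite tree with positive lengths on
its (bounded) edges and `n` labelled ends attached to its vertices, all of valence at least `3`.
The function `len` matters on edges only. -/
structure TropicalCurve (n : ℕ) where
  V : Type
  finite : Finite V
  graph : SimpleGraph V
  isTree : graph.IsTree
  endAt : Fin n → V
  stable : ∀ v, 3 ≤ (graph.neighborSet v).ncard + {i | endAt i = v}.ncard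
  len : Sym2 V → ℝ
  len_pos : ∀ e ∈ graph.edgeSet, 0 < len e

/-- `Φ : ℝⁿ → ℝ^{n choose 2}`, `x ↦ (x_i + x_j)_{i < j}`. -/
def pairSum (n : ℕ) : (Fin n → ℝ) →ₗ[ℝ] ({p : Fin n × Fin n // p.1 < p.2} → ℝ) where
  toFun x p := x p.1.1 + x p.1.2
  map_add' x y := by ext p; simp only [Pi.add_apply]; ring
  map_smul' c x := by ext p; simp only [Pi.smul_apply, smul_eq_mul, RingHom.id_apply]; ring

/-- `Q_n = ℝ^{n choose 2} / Φ(ℝⁿ)`. -/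
abbrev QSpace (n : ℕ) : Type := ({p : Fin n × Fin n // p.1 < p.2} → ℝ) ⧸ LinearMap.range (pairSum n)

namespace TropicalCurve

variable {n : ℕ} (C C' : TropicalCurve n)

/-- The path in the tree between two vertices. -/
noncomputable def path (u v : C.V) : C.graph.Walk u v :=
  (C.isTree.existsUnique_path u v).choose

/-- The distance of two vertices for edge lengths `w`. -/
noncomputable def distOf (w : Sym2 C.V → ℝ) (u v : C.V) : ℝ := ((C.path u v).edges.map w).sum

/-- Edge lengths `w` give the vector `(dist(i, j))_{i < j}` in `Q_n`. -/
noncomputable def distMap : (Sym2 C.V → ℝ) →ₗ[ℝ] QSpace n :=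
  (LinearMap.range (pairSum n)).mkQ ∘ₗ
    { toFun := fun w p => C.distOf w (C.endAt p.1.1) (C.endAt p.1.2)
      map_add' := by
        intro w w'
        ext p
        simp only [distOf, Pi.add_apply]
        exact List.sum_map_add
      map_smul' := by
        intro c w
        ext p
        simp only [distOf, Pi.smul_apply, smul_eq_mul, RingHom.id_apply]
        exact List.sum_map_mul_left _ _ _ }

/-- The vector `d(C)` in `Q_n`. -/
noncomputable def distVec : QSpace n := C.distMap C.len

/-- Isomorphism of tropical curves. -/
def Isom : Prop :=
  ∃ φ : C.graph ≃g C'.graph, (∀ i, φ (C.endAt i) = C'.endAt i) ∧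
    ∀ e ∈ C.graph.edgeSet, C'.len (e.map φ) = C.len e

variable {C C'}

theorem path_eq {u v : C.V} {p : C.graph.Walk u v} (hp : p.IsPath) : p = C.path u v :=
  (C.isTree.existsUnique_path u v).unique hp (C.isTree.existsUnique_path u v).choose_spec.1

theorem Isom.distVec_eq (h : C.Isom C') : C.distVec = C'.distVec := by
  obtain ⟨φ, hend, hlen⟩ := h
  unfold distVec distMap
  simp only [LinearMap.comp_apply]
  congr 1
  ext p
  simp only [LinearMap.coe_mk, AddHom.coe_mk, distOf]
  rw [← hend, ← hend]
  have hp : ((C.path (C.endAt p.1.1) (C.endAt p.1.2)).map φ.toHom).IsPath :=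
    SimpleGraph.Walk.IsPath.map φ.injective
      (C.isTree.existsUnique_path _ _).choose_spec.1
  have := path_eq hp
  change _ = ((C'.path (φ.toHom (C.endAt p.1.1)) (φ.toHom (C.endAt p.1.2))).edges.map C'.len).sum
  rw [← this, SimpleGraph.Walk.edges_map, List.map_map]
  congr 1
  apply List.map_congr_left
  intro e he
  exact (hlen e (SimpleGraph.Walk.edges_subset_edgeSet _ he)).symm

variable (n) in
/-- Isomorphism is an equivalence relation. -/
instance isomSetoid : Setoid (TropicalCurve n) where
  r := Isom
  iseqv :=
    { refl := fun C => ⟨SimpleGraph.Iso.refl, fun _ => rfl, fun e _ => by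
        congr 1
        exact congrFun Sym2.map_id e⟩
      symm := by
        rintro C C' ⟨φ, h1, h2⟩
        refine ⟨φ.symm, fun i => ?_, fun e he => ?_⟩
        · rw [← h1]; exact φ.symm_apply_apply _
        · have hmem : e.map φ.symm ∈ C.graph.edgeSet := by
            induction e with
            | _ x y => exact φ.symm.map_adj_iff.2 he
          rw [← h2 _ hmem, Sym2.map_map]
          congr 1
          have : (φ ∘ φ.symm : C'.V → C'.V) = id := funext fun x => φ.apply_symm_apply x
          rw [this]
          exact congrFun Sym2.map_id e
      trans := by
        rintro C C' C'' ⟨φ, h1, h2⟩ ⟨ψ, h3, h4⟩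
        refine ⟨φ.trans ψ, fun i => ?_, fun e he => ?_⟩
        · rw [← h3, ← h1]; rfl
        · have hmem : e.map φ ∈ C'.graph.edgeSet := by
            induction e with
            | _ x y => exact φ.map_adj_iff.2 he
          rw [← h2 e he, ← h4 _ hmem, Sym2.map_map]
          rfl }

end TropicalCurve

namespace TropicalCurve

variable {n : ℕ} [NeZero n] (C C' : TropicalCurve n)

/-- The root vertex, which carries the first end. -/
def root : C.V := C.endAt 0

/-- The distance from the root. -/
noncomputable def height (v : C.V) : ℝ := C.distOf C.len C.root v

/-- Two curves have the same radially aligned combinatorial type if an isomorphism of the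
underlying trees with labelled ends preserves the weak orderings of the vertices by their distance
from the root. -/
def SameRadialType : Prop :=
  ∃ φ : C.graph ≃g C'.graph, (∀ i, φ (C.endAt i) = C'.endAt i) ∧
    ∀ u v, C.height u ≤ C.height v ↔ C'.height (φ u) ≤ C'.height (φ v)

variable (n) in
/-- Having the same radially aligned combinatorial type is an equivalence relation. -/
def radialSetoid : Setoid (TropicalCurve n) where
  r := SameRadialType
  iseqv :=
    { refl := fun C => ⟨SimpleGraph.Iso.refl, fun _ => rfl, fun _ _ => Iff.rfl⟩
      symm := by
        rintro C C' ⟨φ, h1, h2⟩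
        refine ⟨φ.symm, fun i => ?_, fun u v => ?_⟩
        · rw [← h1]; exact φ.symm_apply_apply _
        · rw [h2, φ.apply_symm_apply, φ.apply_symm_apply]
      trans := by
        rintro C C' C'' ⟨φ, h1, h2⟩ ⟨ψ, h3, h4⟩
        exact ⟨φ.trans ψ, fun i => by rw [← h3, ← h1]; rfl, fun u v => (h2 u v).trans (h4 _ _)⟩ }

/-- The closed cone of (possibly degenerate) edge lengths on the tree of `C` that respect the weak
ordering of the vertices of `C`. -/
def alignedLengths : PointedCone ℝ (Sym2 C.V → ℝ) where
  carrier := {w | (∀ e ∈ C.graph.edgeSet, 0 ≤ w e) ∧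
    ∀ u v, C.height u ≤ C.height v → C.distOf w C.root u ≤ C.distOf w C.root v}
  zero_mem' := ⟨fun _ _ => le_rfl, fun u v _ => by
    have h0 : ∀ x, C.distOf 0 C.root x = 0 := fun x => by
      simp [distOf, Pi.zero_def]
    rw [h0, h0]⟩
  add_mem' := by
    rintro w w' ⟨h1, h2⟩ ⟨h3, h4⟩
    refine ⟨fun e he => add_nonneg (h1 e he) (h3 e he), fun u v h => ?_⟩
    have hadd : ∀ x, C.distOf (w + w') C.root x = C.distOf w C.root x + C.distOf w' C.root x :=
      fun x => List.sum_map_add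
    rw [hadd, hadd]
    exact add_le_add (h2 u v h) (h4 u v h)
  smul_mem' := by
    rintro c w ⟨h1, h2⟩
    refine ⟨fun e he => mul_nonneg c.2 (h1 e he), fun u v h => ?_⟩
    have hsmul : ∀ x, C.distOf (c • w) C.root x = (c : ℝ) * C.distOf w C.root x :=
      fun x => List.sum_map_mul_left _ _ _
    rw [hsmul, hsmul]
    exact mul_le_mul_of_nonneg_left (h2 u v h) c.2

/-- The cone in `Q_n` of the radially aligned combinatorial type of `C`. -/
noncomputable def radialCone : PointedCone ℝ (QSpace n) := C.alignedLengths.map C.distMap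

/-- The radially aligned combinatorial type of `C` is a face of that of `C'`: it arises by
contracting edges (a surjection with connected fibres) and weakening the ordering of the
vertices. -/
def IsFaceOf : Prop :=
  ∃ c : C'.V → C.V, Function.Surjective c ∧ (∀ i, c (C'.endAt i) = C.endAt i) ∧
    (∀ u v, C'.graph.Adj u v → c u = c v ∨ C.graph.Adj (c u) (c v)) ∧
    (∀ x, (C'.graph.induce (c ⁻¹' {x})).Connected) ∧
    ∀ u v, C'.height u ≤ C'.height v → C.height (c u) ≤ C.height (c v)

/-- Delete everything within distance `< t` of the root; the result is the disjoint union of the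
complete graphs on the sets of ends of the remaining connected components (as a set of edges). -/
def levelFlat (t : ℝ) : Set (Sym2 {i : Fin n // i ≠ 0}) :=
  {e | ∃ i j, i ≠ j ∧ e = s(i, j) ∧
    ∃ p : C.graph.Walk (C.endAt i) (C.endAt j), ∀ v ∈ p.support, t ≤ C.height v}

/-- The flats of `C`, one for each distance from the root that occurs at a non-root vertex. -/
def levelFlats : Set (Set (Sym2 {i : Fin n // i ≠ 0})) :=
  {F | ∃ v, v ≠ C.root ∧ F = C.levelFlat (C.height v)}

end TropicalCurve

/-- The points of `M_{0,n}^rad`: isomorphism classes of (radially aligned) curves. The radial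
alignment of a curve is determined by its edge lengths. -/
def MRad (n : ℕ) : Type 1 := Quotient (TropicalCurve.isomSetoid n)

/-- The embedding `C ↦ d(C)` of the moduli space in `Q_n`. -/
noncomputable def MRad.embed {n : ℕ} : MRad n → QSpace n :=
  Quotient.lift TropicalCurve.distVec fun _ _ h => h.distVec_eq

/-- The radially aligned combinatorial types of `n`-marked rational tropical curves. -/
def RadialType (n : ℕ) [NeZero n] : Type 1 := Quotient (TropicalCurve.radialSetoid n)

/-- The radially aligned combinatorial type of a curve. -/
def TropicalCurve.radialType {n : ℕ} [NeZero n] (C : TropicalCurve n) : RadialType n :=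
  Quotient.mk (TropicalCurve.radialSetoid n) C

/-- The fan `M_{0,n}^rad` in `Q_n`: one cone for each radially aligned combinatorial type. -/
def radialFan (n : ℕ) [NeZero n] : Set (PointedCone ℝ (QSpace n)) :=
  Set.range (TropicalCurve.radialCone (n := n))

/-- The cycle matroid of `K_{n-1}`, whose vertices are the marks other than the first. -/
noncomputable abbrev completeMatroid (n : ℕ) [NeZero n] : Matroid (Sym2 {i : Fin n // i ≠ 0}) :=
  cycleMatroid (⊤ : SimpleGraph {i : Fin n // i ≠ 0})

open Classical in
/-- The vector `ρ_I` in `Q_n` of the curve with one bounded edge, of length `1`, that splits the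
ends in `I` from those not in `I`. -/
noncomputable def splitRay {n : ℕ} (I : Set (Fin n)) : QSpace n :=
  (LinearMap.range (pairSum n)).mkQ fun p => if p.1.1 ∈ I ↔ p.1.2 ∈ I then 0 else 1

/-- The edges of the complete graph on a vertex set `I`. -/
def cliqueEdges {V : Type*} (I : Set V) : Set (Sym2 V) :=
  {e | ∃ i ∈ I, ∃ j ∈ I, i ≠ j ∧ e = s(i, j)}

/-! ### Linear images of fans -/

/-! The isomorphism is induced by the negative Gromov product based at the first mark, `(d(i,j) -
d(1,i) - d(1,j)) / 2`. On the distance vector of a curve it takes the value minus the height of the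
vertex where the paths from the root to `i` and `j` part (`gromovEquiv_distMap`), and it is constant
on all pairs exactly for the vectors `x_i + x_j` (`ker_gromovMap`). So a curve becomes the weight `e
↦ -height (endMeet e)` on the edges of the complete graph.

On the matroid side, a weight lies in the Bergman set iff no element is spanned by strictly lighter
ones (`mem_bergmanSet_iff`), so its sublevel sets are flats. It lies in the cone of a chain iff it
is monotone for the preorder which the chain puts on the ground set (`mkQ_mem_flatCone_iff`). The
fan axioms follow from this criterion and the spanning rays, and are transported to `Q_n` at the
end.

Flats of the complete graph are transitive edge sets (`cycleMatroid_top_isFlat_iff`). Hence the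
negative of a Bergman weight, shifted to have minimum `0`, satisfies the ultrametric inequality; its
balls with at least two elements, ordered by inclusion, are the vertices of a curve with these
heights (`IsUltraWeight.curve`). Conversely, stability makes every vertex of a curve the meet of two
ends (`exists_endMeet_eq`), so the heights of the meets determine the curve and their weak ordering
determines its type. Inclusion of chains means that one such ordering weakens the other, and the
induced map on meets is the contraction of trees (`levelFlats_subset_iff_isFaceOf`). Both kinds of
cones thus describe the same monotone functions (`map_radialCone`). -/

theorem IsPolyhedralFan.of_image_map {V W : Type*} [AddCommGroup V] [Module ℝ V] [AddCommGroup W]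
    [Module ℝ W] (L : V ≃ₗ[ℝ] W) {X : Set (PointedCone ℝ V)}
    (h : IsPolyhedralFan ((fun σ : PointedCone ℝ V => σ.map L.toLinearMap) '' X)) :
    IsPolyhedralFan X := by
  have hL : Function.Injective L.toLinearMap := L.injective
  have hinj : Function.Injective (fun σ : PointedCone ℝ V => σ.map L.toLinearMap) :=
    Submodule.map_injective_of_injective
      (f := (L.toLinearMap.restrictScalars {c : ℝ // 0 ≤ c})) hL
  have hinf : ∀ σ τ : PointedCone ℝ V,
      (σ ⊓ τ).map L.toLinearMap = σ.map L.toLinearMap ⊓ τ.map L.toLinearMap := fun σ τ =>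
    Submodule.map_inf (L.toLinearMap.restrictScalars {c : ℝ // 0 ≤ c}) hL
  refine ⟨h.nonempty.of_image, h.finite.of_finite_image hinj.injOn, fun σ hσ => ?_,
    fun σ hσ τ hτ => ?_, fun σ hσ τ hτ => ?_⟩
  · exact Submodule.fg_of_fg_map_injective (L.toLinearMap.restrictScalars {c : ℝ // 0 ≤ c}) hL
      (h.polyhedral _ ⟨σ, hσ, rfl⟩)
  · obtain ⟨ρ, hρ, h2⟩ := h.face_mem _ ⟨σ, hσ, rfl⟩ _ (hτ.map _ hL)
    exact hinj h2 ▸ hρ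
  · have := h.inter_face _ ⟨σ, hσ, rfl⟩ _ ⟨τ, hτ, rfl⟩
    simp only [← hinf] at this
    exact ⟨this.1.of_map_injective hL, this.2.of_map_injective hL⟩

namespace Matroid

variable {α : Type*} {M : Matroid α}

/-! ### Weights that are monotone along a chain of sets -/

/-- The weight `f` is monotone for the preorder on the ground set in which `e` lies below `e'` if
every member of `S` that contains `e'` contains `e`. -/
def MonotoneAlong (M : Matroid α) (S : Set (Set α)) (f : M.E → ℝ) : Prop :=
  ∀ e e' : M.E, (∀ F ∈ S, (e' : α) ∈ F → (e : α) ∈ F) → f e ≤ f e'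

/-- The elements of weight less than `t`. -/
def sublevel (f : M.E → ℝ) (t : ℝ) : Set α := {e | ∃ h : e ∈ M.E, f ⟨e, h⟩ < t}

theorem mem_sublevel {f : M.E → ℝ} {t : ℝ} (e : M.E) : (e : α) ∈ sublevel f t ↔ f e < t :=
  ⟨fun h => h.2, fun h => ⟨e.2, h⟩⟩

theorem sublevel_subset_ground (f : M.E → ℝ) (t : ℝ) : sublevel f t ⊆ M.E := fun _ h => h.1

theorem MonotoneAlong.mono {S T : Set (Set α)} {f : M.E → ℝ} (h : M.MonotoneAlong S f)
    (hST : S ⊆ T) : M.MonotoneAlong T f := fun e e' hle => h e e' fun F hF => hle F (hST hF)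

theorem MonotoneAlong.add {S : Set (Set α)} {f g : M.E → ℝ} (hf : M.MonotoneAlong S f)
    (hg : M.MonotoneAlong S g) : M.MonotoneAlong S (f + g) :=
  fun e e' h => add_le_add (hf e e' h) (hg e e' h)

theorem MonotoneAlong.smul {S : Set (Set α)} {f : M.E → ℝ} (hf : M.MonotoneAlong S f) {c : ℝ}
    (hc : 0 ≤ c) : M.MonotoneAlong S (c • f) :=
  fun e e' h => mul_le_mul_of_nonneg_left (hf e e' h) hc

theorem MonotoneAlong.congr {S : Set (Set α)} {f g : M.E → ℝ} {c : ℝ}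
    (hf : M.MonotoneAlong S f) (h : ∀ e, g e = f e + c) : M.MonotoneAlong S g := fun e e' hle => by
  rw [h, h]; exact add_le_add_left (hf e e' hle) c

theorem monotoneAlong_indicator {S : Set (Set α)} {F : Set α} (hF : F ∈ S) :
    M.MonotoneAlong S (-({x : M.E | (x : α) ∈ F}.indicator 1)) := by
  intro e e' h
  by_cases h1 : (e' : α) ∈ F
  · simp [Set.indicator, h1, h F hF h1]
  · simp only [Pi.neg_apply, Set.indicator, Set.mem_ofPred_eq, h1, if_false]
    split_ifs <;> simp

/-- Along a chain, two elements are always comparable. -/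
theorem _root_.IsChain.comparable_elements {S : Set (Set α)} (hS : IsChain (· ⊆ ·) S) (e e' : α) :
    (∀ F ∈ S, e' ∈ F → e ∈ F) ∨ (∀ F ∈ S, e ∈ F → e' ∈ F) := by
  by_contra! h
  obtain ⟨⟨F, hF, h1, h2⟩, G, hG, h3, h4⟩ := h
  rcases hS.total hF hG with h | h
  · exact h4 (h h1)
  · exact h2 (h h3)

/-- Rank an element by the number of members of the chain that contain it. An element of least rank
inside the sublevel set and one of greatest rank outside it must be separated by some member, and
that member is the whole sublevel set. -/
theorem sublevel_mem_of_monotoneAlong [Finite α] {S : Set (Set α)} (hS : IsChain (· ⊆ ·) S)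
    (hSE : ∀ F ∈ S, F ⊆ M.E) {f : M.E → ℝ} (hf : M.MonotoneAlong S f) {t : ℝ}
    (hne : (sublevel f t).Nonempty) (hE : sublevel f t ≠ M.E) : sublevel f t ∈ S := by
  let r : α → ℕ := fun e => {F ∈ S | e ∈ F}.ncard
  have hr : ∀ F ∈ S, ∀ e ∈ F, ∀ g, g ∉ F → r g < r e := by
    intro F hF e he g hg
    refine Set.ncard_lt_ncard ⟨fun G hG => ⟨hG.1, ?_⟩, fun hsub => hg (hsub ⟨hF, he⟩).2⟩
      (Set.toFinite _)
    rcases hS.total hF hG.1 with h | h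
    · exact h he
    · exact absurd (h hG.2) hg
  have hne' : (M.E \ sublevel f t).Nonempty := by
    rw [Set.sdiff_nonempty]
    exact fun h => hE ((sublevel_subset_ground f t).antisymm h)
  obtain ⟨e, he, hemin⟩ := Set.exists_min_image _ r (Set.toFinite _) hne
  obtain ⟨e', he', hemax⟩ := Set.exists_max_image _ r (Set.toFinite _) hne'
  have hlt : f ⟨e, he.1⟩ < f ⟨e', he'.1⟩ :=
    he.2.trans_le (not_lt.1 fun h => he'.2 ⟨he'.1, h⟩)
  have : ∃ F ∈ S, e ∈ F ∧ e' ∉ F := by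
    by_contra! h
    exact hlt.not_ge (hf ⟨e', he'.1⟩ ⟨e, he.1⟩ h)
  obtain ⟨F, hF, h1, h2⟩ := this
  have hsub : F ⊆ sublevel f t := by
    intro x hx
    by_contra hxs
    exact (hemax x ⟨hSE F hF hx, hxs⟩).not_gt (hr F hF x hx e' h2)
  have hsup : sublevel f t ⊆ F := by
    intro x hx
    by_contra hxF
    exact (hemin x hx).not_gt (hr F hF e h1 x hxF)
  exact hsup.antisymm hsub ▸ hF

theorem monotoneAlong_of_sublevel_mem {S : Set (Set α)} {f : M.E → ℝ}
    (h : ∀ t, (sublevel f t).Nonempty → sublevel f t ≠ M.E → sublevel f t ∈ S) :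
    M.MonotoneAlong S f := by
  intro e e' hle
  by_contra! hlt
  have h1 : (e' : α) ∈ sublevel f (f e) := (mem_sublevel e').2 hlt
  have h2 : (e : α) ∉ sublevel f (f e) := fun h => lt_irrefl _ ((mem_sublevel e).1 h)
  exact h2 (hle _ (h (f e) ⟨_, h1⟩ fun hE => h2 (hE.symm.subset e.2)) h1)

/-! ### The cones of chains of flats -/

theorem mkQ_lineality_eq_iff {f g : M.E → ℝ} :
    M.lineality.mkQ f = M.lineality.mkQ g ↔ ∃ c, ∀ e, f e = g e + c := by
  rw [← sub_eq_zero, ← map_sub, Submodule.mkQ_apply, Submodule.Quotient.mk_eq_zero, lineality,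
    Submodule.mem_span_singleton]
  refine exists_congr fun c => ?_
  rw [funext_iff]
  refine forall_congr' fun e => ?_
  simp only [Pi.smul_apply, Pi.sub_apply, smul_eq_mul, mul_one]
  constructor <;> intro h <;> linarith

theorem ChainOfFlats.subset_ground (S : M.ChainOfFlats) : ∀ F ∈ S.1, F ⊆ M.E :=
  fun F hF => (S.2.2 F hF).1.subset_ground

theorem exists_monotoneAlong_of_mem_flatCone (S : M.ChainOfFlats) {x : M.BergmanSpace}
    (hx : x ∈ M.flatCone S) : ∃ f, M.lineality.mkQ f = x ∧ M.MonotoneAlong S.1 f := by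
  induction hx using Submodule.span_induction with
  | mem x h =>
    obtain ⟨F, hF, rfl⟩ := h
    exact ⟨_, rfl, monotoneAlong_indicator hF⟩
  | zero => exact ⟨0, map_zero _, fun _ _ _ => le_rfl⟩
  | add x y _ _ hx hy =>
    obtain ⟨f, rfl, hf⟩ := hx
    obtain ⟨g, rfl, hg⟩ := hy
    exact ⟨f + g, map_add _ _ _, hf.add hg⟩
  | smul a x _ hx =>
    obtain ⟨f, rfl, hf⟩ := hx
    exact ⟨(a : ℝ) • f, map_smul _ _ _, hf.smul a.2⟩

/-- Induction on the number of values: lowering the largest value to the second largest changes the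
weight, modulo constants, by a nonnegative multiple of the ray of the sublevel set below the
maximum. -/
theorem mkQ_mem_flatCone_of_monotoneAlong [Finite α] (S : M.ChainOfFlats) {f : M.E → ℝ}
    (hf : M.MonotoneAlong S.1 f) : M.lineality.mkQ f ∈ M.flatCone S := by
  induction hk : (Set.range f).ncard using Nat.strong_induction_on generalizing f with
  | _ k ih =>
  rcases isEmpty_or_nonempty M.E with hE | hE
  · rw [Subsingleton.elim f 0, map_zero]
    exact Submodule.zero_mem _
  obtain ⟨e₀, he₀⟩ := Finite.exists_max f
  by_cases hconst : ∀ e, f e = f e₀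
  · have : M.lineality.mkQ f = M.lineality.mkQ 0 :=
      mkQ_lineality_eq_iff.2 ⟨f e₀, fun e => by rw [hconst e]; simp⟩
    rw [this, map_zero]
    exact Submodule.zero_mem _
  have hne : {e | f e < f e₀}.Nonempty := by
    by_contra h
    rw [Set.not_nonempty_iff_eq_empty] at h
    exact hconst fun e => (he₀ e).antisymm (not_lt.1 fun h' => by
      have : e ∈ {e | f e < f e₀} := h'
      rw [h] at this
      exact this)
  obtain ⟨e₁, he₁, hmax⟩ := Set.exists_max_image _ f (Set.toFinite _) hne
  have he₁ : f e₁ < f e₀ := he₁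
  have hG : sublevel f (f e₀) ∈ S.1 :=
    sublevel_mem_of_monotoneAlong S.2.1 S.subset_ground hf ⟨e₁, (mem_sublevel e₁).2 he₁⟩
      fun h => lt_irrefl _ ((mem_sublevel e₀).1 (h.symm.subset e₀.2))
  let g : M.E → ℝ := fun e => min (f e) (f e₁)
  have hg : M.MonotoneAlong S.1 g := fun e e' h => min_le_min_right _ (hf e e' h)
  have hcard : (Set.range g).ncard < k := by
    rw [← hk]
    refine Set.ncard_lt_ncard ⟨?_, fun h => ?_⟩ (Set.toFinite _)
    · rintro _ ⟨e, rfl⟩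
      rcases min_choice (f e) (f e₁) with h | h
      · exact ⟨e, h.symm⟩
      · exact ⟨e₁, h.symm⟩
    · obtain ⟨e, he⟩ := h ⟨e₀, rfl⟩
      exact (min_le_right (f e) (f e₁)).not_gt (he₁.trans_eq he.symm)
  have hrec := ih _ hcard hg rfl
  have hray : (⟨f e₀ - f e₁, sub_nonneg.2 he₁.le⟩ : {c : ℝ // 0 ≤ c}) •
      M.flatRay (sublevel f (f e₀)) ∈ M.flatCone S :=
    Submodule.smul_mem _ _ (Submodule.subset_span ⟨_, hG, rfl⟩)
  have heq : M.lineality.mkQ f = M.lineality.mkQ g + (⟨f e₀ - f e₁, sub_nonneg.2 he₁.le⟩ :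
      {c : ℝ // 0 ≤ c}) • M.flatRay (sublevel f (f e₀)) := by
    have h2 : (⟨f e₀ - f e₁, sub_nonneg.2 he₁.le⟩ : {c : ℝ // 0 ≤ c}) •
        M.flatRay (sublevel f (f e₀)) = M.lineality.mkQ ((f e₀ - f e₁) •
          (-({x : M.E | (x : α) ∈ sublevel f (f e₀)}.indicator 1))) := by
      rw [map_smul]; rfl
    rw [h2, ← map_add, mkQ_lineality_eq_iff]
    -- The ray lowers the weight on the sublevel set, whereas its complement has to be raised;
    -- adding this constant turns one into the other.
    refine ⟨f e₀ - f e₁, fun e => ?_⟩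
    simp only [Pi.add_apply, Pi.smul_apply, Pi.neg_apply, smul_eq_mul, Set.indicator,
      Set.mem_ofPred_eq, mem_sublevel, Pi.one_apply, g]
    split_ifs with h
    · rw [min_eq_left (hmax e h)]; ring
    · rw [(he₀ e).antisymm (not_lt.1 h), min_eq_right he₁.le]; ring
  rw [heq]
  exact Submodule.add_mem _ hrec hray

theorem mkQ_mem_flatCone_iff [Finite α] (S : M.ChainOfFlats) {f : M.E → ℝ} :
    M.lineality.mkQ f ∈ M.flatCone S ↔ M.MonotoneAlong S.1 f := by
  refine ⟨fun h => ?_, mkQ_mem_flatCone_of_monotoneAlong S⟩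
  obtain ⟨g, hg, hmono⟩ := exists_monotoneAlong_of_mem_flatCone S h
  obtain ⟨c, hc⟩ := mkQ_lineality_eq_iff.1 hg.symm
  exact hmono.congr hc

/-- A subset of a chain of flats, as a chain of flats. -/
def ChainOfFlats.restrict (S : M.ChainOfFlats) (T : Set (Set α)) (h : T ⊆ S.1) : M.ChainOfFlats :=
  ⟨T, S.2.1.mono h, fun F hF => S.2.2 F (h hF)⟩

/-- Two elements are always comparable along the larger chain. If both summands satisfy the
inequality opposite to the desired one, then the inequality for their sum forces equality in each.
-/
theorem flatCone_isFaceOf [Finite α] {S T : M.ChainOfFlats} (h : T.1 ⊆ S.1) :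
    (M.flatCone T).IsFaceOf (M.flatCone S) := by
  refine .of_mem_of_add_mem_left (Submodule.span_mono (Set.image_mono h)) ?_
  intro x y hx hy hxy
  obtain ⟨f, rfl⟩ := M.lineality.mkQ_surjective x
  obtain ⟨g, rfl⟩ := M.lineality.mkQ_surjective y
  rw [← map_add] at hxy
  rw [mkQ_mem_flatCone_iff] at hx hy hxy ⊢
  intro e e' hle
  rcases S.2.1.comparable_elements (e : α) e' with h | h
  · exact hx e e' h
  · have h1 := hx e' e h
    have h2 := hy e' e h
    have h3 := hxy e e' hle
    simp only [Pi.add_apply] at h3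
    linarith

/-- A face of a cone spanned by rays is spanned by those of the rays that it contains, and any
subset of a chain is a chain. -/
theorem exists_flatCone_eq_of_isFaceOf (S : M.ChainOfFlats)
    {τ : PointedCone ℝ M.BergmanSpace} (h : τ.IsFaceOf (M.flatCone S)) :
    ∃ T : M.ChainOfFlats, M.flatCone T = τ := by
  refine ⟨S.restrict {F ∈ S.1 | M.flatRay F ∈ τ} fun F hF => hF.1, le_antisymm ?_ ?_⟩
  · refine Submodule.span_le.2 ?_
    rintro _ ⟨F, hF, rfl⟩
    exact hF.2
  · have key : ∀ x ∈ M.flatCone S, x ∈ τ →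
        x ∈ M.flatCone (S.restrict {F ∈ S.1 | M.flatRay F ∈ τ} fun F hF => hF.1) := by
      intro x hx
      induction hx using Submodule.span_induction with
      | mem x hx =>
        obtain ⟨F, hF, rfl⟩ := hx
        exact fun h => Submodule.subset_span ⟨F, ⟨hF, h⟩, rfl⟩
      | zero => exact fun _ => Submodule.zero_mem _
      | add x y hx hy ihx ihy =>
        exact fun hxy => Submodule.add_mem _ (ihx (h.mem_of_add_mem_left hx hy hxy))
          (ihy (h.mem_of_add_mem_right hx hy hxy))
      | smul a x hx ih =>
        intro hax
        rcases a.2.eq_or_lt with ha | ha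
        · have : a = 0 := Subtype.ext ha.symm
          rw [this, zero_smul]
          exact Submodule.zero_mem _
        · refine Submodule.smul_mem _ _ (ih (h.mem_of_smul_add_mem hx (Submodule.zero_mem _) ha ?_))
          rw [add_zero]
          exact hax
    exact fun x hx => key x (h.le hx) hx

/-- The proper nonempty sublevel sets of a common point belong to both chains, and a weight is
monotone along any family that contains them. -/
theorem flatCone_inf [Finite α] (S T : M.ChainOfFlats) :
    M.flatCone S ⊓ M.flatCone T =
      M.flatCone (S.restrict (S.1 ∩ T.1) Set.inter_subset_left) := by
  refine le_antisymm ?_ (le_inf (Submodule.span_mono (Set.image_mono Set.inter_subset_left))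
    (Submodule.span_mono (Set.image_mono Set.inter_subset_right)))
  rintro x ⟨hx, hy⟩
  obtain ⟨f, rfl⟩ := M.lineality.mkQ_surjective x
  rw [SetLike.mem_coe, mkQ_mem_flatCone_iff] at hx hy
  rw [mkQ_mem_flatCone_iff]
  exact monotoneAlong_of_sublevel_mem fun t h1 h2 =>
    ⟨sublevel_mem_of_monotoneAlong S.2.1 S.subset_ground hx h1 h2,
      sublevel_mem_of_monotoneAlong T.2.1 T.subset_ground hy h1 h2⟩

/-- A chain is determined by its preorder on the ground set: a member `F` is a sublevel set of minus
its indicator, which is monotone for the other chain. -/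
theorem ChainOfFlats.subset_of_forall [Finite α] {S T : M.ChainOfFlats}
    (h : ∀ e e' : M.E, (∀ F ∈ T.1, (e' : α) ∈ F → (e : α) ∈ F) →
      ∀ F ∈ S.1, (e' : α) ∈ F → (e : α) ∈ F) : S.1 ⊆ T.1 := by
  intro F hF
  have hmono : M.MonotoneAlong T.1 (-({x : M.E | (x : α) ∈ F}.indicator 1)) := fun e e' hle =>
    monotoneAlong_indicator (M := M) (S := S.1) hF e e' (h e e' hle)
  have heq : sublevel (-({x : M.E | (x : α) ∈ F}.indicator 1)) 0 = F := by
    ext x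
    constructor
    · rintro ⟨hx, hlt⟩
      by_contra hxF
      simp [Set.indicator, hxF] at hlt
    · exact fun hx => ⟨S.subset_ground F hF hx, by simp [Set.indicator, hx]⟩
  rw [← heq]
  exact sublevel_mem_of_monotoneAlong T.2.1 T.subset_ground hmono
    (heq.symm ▸ (S.2.2 F hF).2.1) (heq.symm ▸ (S.2.2 F hF).2.2)

/-- A weight in the relative interior of the cone of a chain of flats. -/
theorem ChainOfFlats.exists_strictly_monotoneAlong [Finite α] (S : M.ChainOfFlats) :
    ∃ f : M.E → ℝ, ∀ e e' : M.E, (∀ F ∈ S.1, (e' : α) ∈ F → (e : α) ∈ F) ↔ f e ≤ f e' := by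
  -- The sets of members containing `e` and `e'` are nested, so comparing their cardinalities is the
  -- same as comparing the sets.
  refine ⟨fun e => -({F ∈ S.1 | (e : α) ∈ F}.ncard : ℝ), fun e e' => ?_⟩
  rw [neg_le_neg_iff, Nat.cast_le]
  refine ⟨fun h => Set.ncard_le_ncard (fun F hF => ⟨hF.1, h F hF.1 hF.2⟩) (Set.toFinite _),
    fun h F hF he' => ?_⟩
  have hsub : {F ∈ S.1 | (e : α) ∈ F} ⊆ {F ∈ S.1 | (e' : α) ∈ F} ∨
      {F ∈ S.1 | (e' : α) ∈ F} ⊆ {F ∈ S.1 | (e : α) ∈ F} :=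
    (S.2.1.comparable_elements (e' : α) e).imp (fun h F hF => ⟨hF.1, h F hF.1 hF.2⟩)
      (fun h F hF => ⟨hF.1, h F hF.1 hF.2⟩)
  rcases hsub with hsub | hsub
  · have := Set.eq_of_subset_of_ncard_le hsub h (Set.toFinite _)
    exact (this.symm.subset ⟨hF, he'⟩).2
  · exact (hsub ⟨hF, he'⟩).2

/-- The cones of the chains of flats of a finite matroid form a fan. -/
theorem isPolyhedralFan_bergmanFan [Finite α] (M : Matroid α) : IsPolyhedralFan M.bergmanFan where
  nonempty := ⟨_, ⟨∅, by simp, by simp⟩, rfl⟩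
  finite := by
    have : Finite M.ChainOfFlats := Subtype.finite
    exact Set.finite_range _
  polyhedral := by
    rintro _ ⟨S, rfl⟩
    exact Submodule.fg_span (Set.toFinite _)
  face_mem := by
    rintro _ ⟨S, rfl⟩ τ hτ
    exact exists_flatCone_eq_of_isFaceOf S hτ
  inter_face := by
    rintro _ ⟨S, rfl⟩ _ ⟨T, rfl⟩
    rw [flatCone_inf]
    exact ⟨flatCone_isFaceOf Set.inter_subset_left, flatCone_isFaceOf Set.inter_subset_right⟩

/-! ### The support of the Bergman fan -/

theorem finsum_exchange [Finite α] (w : M.E → ℝ) {B : Set α} {e f : M.E} (he : (e : α) ∈ B)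
    (hf : (f : α) ∉ B) :
    ∑ᶠ x : {x : M.E // (x : α) ∈ insert (f : α) (B \ {(e : α)})}, w x.1 =
      ∑ᶠ x : {x : M.E // (x : α) ∈ B}, w x.1 - w e + w f := by
  have hsum : ∀ A : Set α, ∑ᶠ x : {x : M.E // (x : α) ∈ A}, w x.1 =
      ∑ᶠ x ∈ {x : M.E | (x : α) ∈ A}, w x := fun A => finsum_subtype_eq_finsum_cond _
  have h1 : {x : M.E | (x : α) ∈ B} = insert e {x : M.E | (x : α) ∈ B \ {(e : α)}} := by
    ext x
    by_cases hx : x = e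
    · simp [hx, he]
    · simp [hx, Subtype.coe_inj]
  have h2 : {x : M.E | (x : α) ∈ insert (f : α) (B \ {(e : α)})} =
      insert f {x : M.E | (x : α) ∈ B \ {(e : α)}} := by
    ext x
    simp [Subtype.coe_inj]
  rw [hsum, hsum, h1, h2, finsum_mem_insert _ _ (Set.toFinite _),
    finsum_mem_insert _ _ (Set.toFinite _)]
  · ring
  · simp
  · simp [hf]

/-- This is the exchange argument behind the greedy algorithm. If lighter elements span `e`, one of
them can replace `e` in any base containing it and reduce the weight. If not, the fundamental
circuit of `e` in a minimal base has another element at least as heavy as `e`, and `e` can replace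
it. -/
theorem mem_bergmanSet_iff [Finite α] {w : M.E → ℝ} :
    w ∈ M.bergmanSet ↔ ∀ e : M.E, (e : α) ∉ M.closure (sublevel w (w e)) := by
  constructor
  · rintro h e hcl
    obtain ⟨B, hB, heB, hmin⟩ := h e e.2
    have : ∃ f : M.E, w f < w e ∧ (f : α) ∉ M.closure (B \ {(e : α)}) := by
      by_contra! hall
      refine hB.indep.notMem_closure_sdiff_of_mem heB
        (M.closure_subset_closure_of_subset_closure ?_ hcl)
      exact fun x hx => hall ⟨x, hx.1⟩ hx.2
    obtain ⟨f, hlt, hf⟩ := this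
    have hfB : (f : α) ∉ B := by
      intro hfB
      refine hf (M.mem_closure_of_mem' ⟨hfB, ?_⟩)
      rw [Set.mem_singleton_iff, Subtype.coe_inj]
      rintro rfl
      exact lt_irrefl _ hlt
    have hind := (((hB.indep.subset Set.sdiff_subset).notMem_closure_iff f.2).1 hf).1
    have := hmin _ (hB.exchange_isBase_of_indep hfB hind)
    rw [finsum_exchange w heB hfB] at this
    linarith
  · intro h e he
    let wt : Set α → ℝ := fun B => ∑ᶠ x : {x : M.E // (x : α) ∈ B}, w x.1
    obtain ⟨B, hB, hmin⟩ := Set.exists_min_image {B | M.IsBase B} wt (Set.toFinite _)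
      M.exists_isBase
    have hB : M.IsBase B := hB
    by_cases heB : e ∈ B
    · exact ⟨B, hB, heB, hmin⟩
    have hcl : e ∈ M.closure B := hB.closure_eq.symm ▸ he
    have hcirc := hB.fundCircuit_isCircuit he heB
    have : ∃ f : M.E, (f : α) ∈ M.fundCircuit e B ∧ (f : α) ≠ e ∧ w ⟨e, he⟩ ≤ w f := by
      by_contra! hall
      refine h ⟨e, he⟩ (M.closure_subset_closure ?_
        (hcirc.mem_closure_sdiff_singleton_of_mem (M.mem_fundCircuit e B)))
      exact fun x hx => ⟨hcirc.subset_ground hx.1, hall ⟨x, hcirc.subset_ground hx.1⟩ hx.1 hx.2⟩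
    obtain ⟨f, hfC, hfe, hle⟩ := this
    have hfB : (f : α) ∈ B := ((M.fundCircuit_subset_insert e B) hfC).resolve_left hfe
    have hind := (hB.indep.mem_fundCircuit_iff hcl heB).1 hfC
    rw [← Set.insert_sdiff_singleton_comm hfe.symm] at hind
    refine ⟨_, hB.exchange_isBase_of_indep heB hind, Set.mem_insert _ _, fun B' hB' => ?_⟩
    have h1 := finsum_exchange (M := M) w (e := f) (f := ⟨e, he⟩) hfB heB
    have h2 : wt B ≤ wt B' := hmin B' hB'
    simp only [wt] at h2
    simp only at h1
    rw [h1]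
    linarith

theorem isFlat_sublevel [Finite α] {w : M.E → ℝ} (hw : w ∈ M.bergmanSet) (t : ℝ) :
    M.IsFlat (sublevel w t) := by
  rw [isFlat_iff_closure_eq]
  refine (M.subset_closure _ (sublevel_subset_ground w t)).antisymm' fun e he => ?_
  have heE : e ∈ M.E := M.closure_subset_ground _ he
  by_contra hlt
  refine mem_bergmanSet_iff.1 hw ⟨e, heE⟩ (M.closure_subset_closure ?_ he)
  exact fun x hx => ⟨hx.1, hx.2.trans_le (not_lt.1 fun h => hlt ⟨heE, h⟩)⟩

/-- The chain of flats formed by the sublevel sets of a point of the Bergman fan. -/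
def sublevelChain [Finite α] (w : M.E → ℝ) (hw : w ∈ M.bergmanSet) : M.ChainOfFlats :=
  ⟨{F | (∃ t, F = sublevel w t) ∧ F.Nonempty ∧ F ≠ M.E}, by
    rintro _ ⟨⟨t, rfl⟩, -⟩ _ ⟨⟨s, rfl⟩, -⟩ -
    rcases le_total t s with h | h
    · exact Or.inl fun x hx => ⟨hx.1, hx.2.trans_le h⟩
    · exact Or.inr fun x hx => ⟨hx.1, hx.2.trans_le h⟩, by
    rintro _ ⟨⟨t, rfl⟩, h⟩
    exact ⟨isFlat_sublevel hw t, h⟩⟩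

theorem monotoneAlong_sublevelChain [Finite α] {w : M.E → ℝ} (hw : w ∈ M.bergmanSet) :
    M.MonotoneAlong (sublevelChain w hw).1 w :=
  monotoneAlong_of_sublevel_mem fun t h1 h2 => ⟨⟨t, rfl⟩, h1, h2⟩

/-- The sublevel set below `w e` is a member of the chain, hence closed, or it is empty, and then
closed since there are no loops. -/
theorem mem_bergmanSet_of_monotoneAlong [Finite α] [M.Loopless] {S : M.ChainOfFlats}
    {w : M.E → ℝ} (hw : M.MonotoneAlong S.1 w) : w ∈ M.bergmanSet := by
  rw [mem_bergmanSet_iff]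
  intro e he
  have hnot : (e : α) ∉ sublevel w (w e) := fun h => lt_irrefl _ ((mem_sublevel e).1 h)
  rcases (sublevel w (w e)).eq_empty_or_nonempty with h | h
  · rw [h, ← loops, M.loops_eq_empty] at he
    exact he
  · have := sublevel_mem_of_monotoneAlong S.2.1 S.subset_ground hw h fun h =>
      hnot (h.symm.subset e.2)
    rw [(S.2.2 _ this).1.closure] at he
    exact hnot he

theorem mkQ_mem_bergmanSet'_iff [Finite α] [M.Loopless] {w : M.E → ℝ} :
    M.lineality.mkQ w ∈ M.bergmanSet' ↔ w ∈ M.bergmanSet := by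
  refine ⟨?_, fun h => ⟨w, h, rfl⟩⟩
  rintro ⟨v, hv, hvw⟩
  obtain ⟨c, hc⟩ := mkQ_lineality_eq_iff.1 hvw.symm
  exact mem_bergmanSet_of_monotoneAlong ((monotoneAlong_sublevelChain hv).congr hc)

theorem iUnion_bergmanFan [Finite α] [M.Loopless] :
    (⋃ σ ∈ M.bergmanFan, (σ : Set M.BergmanSpace)) = M.bergmanSet' := by
  ext x
  obtain ⟨w, rfl⟩ := M.lineality.mkQ_surjective x
  rw [mkQ_mem_bergmanSet'_iff]
  simp only [bergmanFan, Set.mem_iUnion, Set.mem_range, exists_prop, exists_exists_eq_and,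
    SetLike.mem_coe, mkQ_mem_flatCone_iff]
  exact ⟨fun ⟨S, h⟩ => mem_bergmanSet_of_monotoneAlong h,
    fun h => ⟨_, monotoneAlong_sublevelChain h⟩⟩

/-! ### Flats of the cycle matroid of a complete graph -/

section CompleteGraph

variable {V : Type*} [Finite V]

open SimpleGraph

theorem cycleMatroid_top_mem_closure_iff {I : Set (Sym2 V)}
    (hI : (cycleMatroid (⊤ : SimpleGraph V)).Indep I) {u v : V} (huv : u ≠ v) :
    s(u, v) ∈ (cycleMatroid (⊤ : SimpleGraph V)).closure I ↔ (fromEdgeSet I).Reachable u v := by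
  have hE : s(u, v) ∈ (cycleMatroid (⊤ : SimpleGraph V)).E := by
    rw [cycleMatroid_E]; simpa using huv
  rw [← not_iff_not, hI.notMem_closure_iff hE]
  constructor
  · rintro ⟨hins, hnot⟩ hr
    have hadj : (fromEdgeSet (insert s(u, v) I)).Adj u v :=
      (fromEdgeSet_adj _).2 ⟨Set.mem_insert _ _, huv⟩
    have hb := isAcyclic_iff_forall_adj_isBridge.1
      ((cycleMatroid_indep_iff _ _).1 hins).2 hadj
    rw [isBridge_iff] at hb
    refine hb (hr.mono fun x y hxy => ?_)
    rw [fromEdgeSet_adj] at hxy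
    rw [deleteEdges_adj, fromEdgeSet_adj]
    exact ⟨⟨Set.mem_insert_of_mem _ hxy.1, hxy.2⟩, fun h =>
      hnot (Set.mem_singleton_iff.1 h ▸ hxy.1)⟩
  · intro hr
    have hnot : s(u, v) ∉ I := fun h => hr (Adj.reachable ((fromEdgeSet_adj _).2 ⟨h, huv⟩))
    have hI' := (cycleMatroid_indep_iff _ _).1 hI
    refine ⟨(cycleMatroid_indep_iff _ _).2 ⟨Set.insert_subset hE hI'.1,
      (IsAcyclic.sup_edge_of_not_reachable hr hI'.2).anti fun x y hxy => ?_⟩, hnot⟩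
    rw [fromEdgeSet_adj] at hxy
    rw [sup_adj, fromEdgeSet_adj, edge_adj]
    rcases hxy with ⟨h1 | h1, h2⟩
    · rw [Sym2.eq_iff] at h1
      exact Or.inr ⟨by tauto, h2⟩
    · exact Or.inl ⟨h1, h2⟩

/-- An edge is spanned by a set of edges iff its ends are joined by a walk in a basis of that set;
transitivity shortens such a walk to a single edge. So the flats are the disjoint unions of complete
graphs. -/
theorem cycleMatroid_top_isFlat_iff {F : Set (Sym2 V)} :
    (cycleMatroid (⊤ : SimpleGraph V)).IsFlat F ↔ F ⊆ (⊤ : SimpleGraph V).edgeSet ∧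
      ∀ i j k, i ≠ k → s(i, j) ∈ F → s(j, k) ∈ F → s(i, k) ∈ F := by
  constructor
  · intro hF
    refine ⟨hF.subset_ground, fun i j k hik hij hjk => ?_⟩
    have hne : ∀ {a b}, s(a, b) ∈ F → a ≠ b := fun h => by
      have := hF.subset_ground h
      rw [cycleMatroid_E] at this
      simpa using this
    obtain ⟨I, hI⟩ := (cycleMatroid (⊤ : SimpleGraph V)).exists_isBasis F hF.subset_ground
    have hcl := hI.closure_eq_closure.trans hF.closure
    have hij' := hne hij
    have hjk' := hne hjk
    rw [← hcl, cycleMatroid_top_mem_closure_iff hI.indep hij'] at hij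
    rw [← hcl, cycleMatroid_top_mem_closure_iff hI.indep hjk'] at hjk
    rw [← hcl, cycleMatroid_top_mem_closure_iff hI.indep hik]
    exact hij.trans hjk
  · rintro ⟨hF, htrans⟩
    obtain ⟨I, hI⟩ := (cycleMatroid (⊤ : SimpleGraph V)).exists_isBasis F hF
    rw [isFlat_iff_closure_eq]
    refine (subset_closure _ _ hF).antisymm' fun e he => ?_
    have heE := closure_subset_ground _ _ he
    rw [← hI.closure_eq_closure] at he
    induction e with
    | _ u v =>
      rw [cycleMatroid_E] at heE
      have hne : u ≠ v := by simpa using heE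
      rw [cycleMatroid_top_mem_closure_iff hI.indep hne] at he
      obtain ⟨p⟩ := he
      clear heE
      induction p with
      | nil => exact absurd rfl hne
      | @cons a b c hab p ih =>
        have hab' : s(a, b) ∈ F := hI.subset ((fromEdgeSet_adj _).1 hab).1
        by_cases hbc : b = c
        · exact hbc ▸ hab'
        · exact htrans a b c hne hab' (ih hbc)

instance loopless_cycleMatroid_top : (cycleMatroid (⊤ : SimpleGraph V)).Loopless :=
  ⟨(cycleMatroid_top_isFlat_iff.2 ⟨Set.empty_subset _, by simp⟩ :
    (cycleMatroid (⊤ : SimpleGraph V)).IsFlat ∅).closure⟩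

end CompleteGraph

end Matroid

namespace TropicalCurve

open SimpleGraph

/-! ### Paths and distances in the tree of a curve -/

section Distances

variable {n : ℕ} (C : TropicalCurve n)

instance finite_vertices : Finite C.V := C.finite

theorem path_isPath (u v : C.V) : (C.path u v).IsPath :=
  (C.isTree.existsUnique_path u v).choose_spec.1

theorem distOf_eq_of_isPath (w : Sym2 C.V → ℝ) {u v : C.V} {p : C.graph.Walk u v}
    (hp : p.IsPath) : C.distOf w u v = (p.edges.map w).sum := by
  rw [distOf, ← path_eq hp]

theorem support_path_subset {u v : C.V} (p : C.graph.Walk u v) :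
    (C.path u v).support ⊆ p.support := by
  classical
  rw [← path_eq p.bypass_isPath]
  exact p.support_bypass_subset_support

theorem distOf_self (w : Sym2 C.V → ℝ) (u : C.V) : C.distOf w u u = 0 := by
  rw [C.distOf_eq_of_isPath w (Walk.IsPath.nil)]
  simp

theorem distOf_comm (w : Sym2 C.V → ℝ) (u v : C.V) : C.distOf w u v = C.distOf w v u := by
  rw [C.distOf_eq_of_isPath w (C.path_isPath v u).reverse, Walk.edges_reverse, List.map_reverse,
    List.sum_reverse, distOf]

theorem distOf_add_of_mem (w : Sym2 C.V → ℝ) {u v x : C.V} (hx : x ∈ (C.path u v).support) :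
    C.distOf w u v = C.distOf w u x + C.distOf w x v := by
  classical
  rw [C.distOf_eq_of_isPath w ((C.path_isPath u v).takeUntil hx),
    C.distOf_eq_of_isPath w ((C.path_isPath u v).dropUntil hx), ← List.sum_append,
    ← List.map_append, ← Walk.edges_append, Walk.take_spec, distOf]

theorem distOf_of_adj_of_notMem (w : Sym2 C.V → ℝ) {u v x : C.V} (h : C.graph.Adj x u)
    (hx : x ∉ (C.path u v).support) : C.distOf w x v = w s(x, u) + C.distOf w u v := by
  rw [C.distOf_eq_of_isPath w ((C.path_isPath u v).cons (h := h) hx), Walk.edges_cons,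
    List.map_cons, List.sum_cons, distOf]

end Distances

variable {n : ℕ} [NeZero n] (C : TropicalCurve n)

/-! ### The tree order with the root as least element -/

/-- The vertex `u` lies on the path from the root to `v`. -/
def Anc (u v : C.V) : Prop := u ∈ (C.path C.root v).support

theorem anc_refl (v : C.V) : C.Anc v v := Walk.end_mem_support _

theorem root_anc (v : C.V) : C.Anc C.root v := Walk.start_mem_support _

theorem path_root_root : C.path C.root C.root = Walk.nil := (path_eq Walk.IsPath.nil).symm

theorem anc_root {v : C.V} : C.Anc v C.root ↔ v = C.root := by
  rw [Anc, path_root_root]; simp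

/-- `p` is the parent of `v`: the neighbour of `v` on the path from the root. -/
structure IsParent (p v : C.V) : Prop where
  adj : C.graph.Adj p v
  notMem : ¬ C.Anc v p

variable {C}

theorem IsParent.path_isPath {p v : C.V} (h : C.IsParent p v) :
    ((C.path C.root p).concat h.adj).IsPath :=
  (C.path_isPath _ _).concat h.notMem h.adj

theorem IsParent.anc_iff {p v : C.V} (h : C.IsParent p v) {y : C.V} :
    C.Anc y v ↔ y = v ∨ C.Anc y p := by
  rw [Anc, ← path_eq h.path_isPath, Walk.support_concat]
  simp only [List.mem_append, List.mem_singleton, Anc]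
  tauto

theorem IsParent.anc {p v : C.V} (h : C.IsParent p v) : C.Anc p v :=
  h.anc_iff.2 (Or.inr (C.anc_refl p))

theorem IsParent.length_path {p v : C.V} (h : C.IsParent p v) :
    (C.path C.root v).length = (C.path C.root p).length + 1 := by
  rw [← path_eq h.path_isPath, Walk.length_concat]

theorem IsParent.distOf_root {p v : C.V} (h : C.IsParent p v) (w : Sym2 C.V → ℝ) :
    C.distOf w C.root v = C.distOf w C.root p + w s(p, v) := by
  rw [C.distOf_eq_of_isPath w h.path_isPath, Walk.edges_concat, List.concat_eq_append,
    List.map_append, List.sum_append, distOf]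
  simp

theorem exists_isParent {v : C.V} (hv : v ≠ C.root) : ∃ p, C.IsParent p v := by
  have hp := (C.path_isPath C.root v).reverse
  cases hq : (C.path C.root v).reverse with
  | nil => exact absurd rfl hv
  | @cons _ p _ h q =>
    rw [hq, Walk.cons_isPath_iff] at hp
    refine ⟨p, h.symm, ?_⟩
    rw [Anc, ← path_eq hp.1.reverse, Walk.support_reverse, List.mem_reverse]
    exact hp.2

theorem not_isParent_root (p : C.V) : ¬ C.IsParent p C.root := fun h => h.notMem (C.root_anc p)

theorem isParent_or_of_adj {u v : C.V} (h : C.graph.Adj u v) :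
    C.IsParent u v ∨ C.IsParent v u := by
  by_cases huv : C.Anc v u
  · right
    refine ⟨h.symm, fun hvu => ?_⟩
    -- Unit lengths count edges. If each of `u`, `v` lay on the root path of the other, their
    -- distance would be `0` rather than `1`.
    have h2 := C.distOf_add_of_mem (fun _ => 1) huv
    have h3 := C.distOf_add_of_mem (fun _ => 1) hvu
    have h4 : C.distOf (fun _ => 1) u v = 1 := by
      have : (Walk.cons h Walk.nil).IsPath := by simp [h.ne]
      rw [C.distOf_eq_of_isPath _ this]
      simp
    have h5 := C.distOf_comm (fun _ => 1) u v
    linarith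
  · exact Or.inl ⟨h, huv⟩

@[elab_as_elim]
theorem rootInduction {P : C.V → Prop} (root : P C.root)
    (step : ∀ p v, C.IsParent p v → P p → P v) (v : C.V) : P v := by
  induction hk : (C.path C.root v).length using Nat.strong_induction_on generalizing v with
  | _ k ih =>
    by_cases hv : v = C.root
    · exact hv ▸ root
    · obtain ⟨p, hp⟩ := exists_isParent hv
      exact step p v hp (ih _ (by rw [← hk, hp.length_path]; exact Nat.lt_succ_self _) p rfl)

theorem Anc.trans {x y z : C.V} (hxy : C.Anc x y) (hyz : C.Anc y z) : C.Anc x z := by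
  induction z using rootInduction with
  | root => rwa [C.anc_root.1 hyz] at hxy
  | step p v hp ih =>
    rcases hp.anc_iff.1 hyz with rfl | h
    · exact hxy
    · exact hp.anc_iff.2 (Or.inr (ih h))

theorem Anc.total {x y z : C.V} (hx : C.Anc x z) (hy : C.Anc y z) : C.Anc x y ∨ C.Anc y x := by
  induction z using rootInduction with
  | root =>
    rw [C.anc_root.1 hx]
    exact Or.inl (C.root_anc y)
  | step p v hp ih =>
    rcases hp.anc_iff.1 hx with rfl | h
    · exact Or.inr hy
    · rcases hp.anc_iff.1 hy with rfl | h'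
      · exact Or.inl hx
      · exact ih h h'

theorem Anc.antisymm {x y : C.V} (hxy : C.Anc x y) (hyx : C.Anc y x) : x = y := by
  by_contra hne
  by_cases hx : x = C.root
  · exact hne (by rw [hx] at hyx ⊢; exact (C.anc_root.1 hyx).symm)
  · obtain ⟨p, hp⟩ := exists_isParent hx
    have h1 := (hp.anc_iff.1 hyx).resolve_left (Ne.symm hne)
    exact hp.notMem (hxy.trans h1)

theorem IsParent.unique {p q v : C.V} (hp : C.IsParent p v) (hq : C.IsParent q v) : p = q := by
  have h1 := (hp.anc_iff.1 hq.anc).resolve_left hq.adj.ne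
  have h2 := (hq.anc_iff.1 hp.anc).resolve_left hp.adj.ne
  exact h2.antisymm h1

theorem Anc.exists_child {x y : C.V} (h : C.Anc x y) (hne : x ≠ y) :
    ∃ a, C.IsParent x a ∧ C.Anc a y := by
  induction y using rootInduction with
  | root => exact absurd (C.anc_root.1 h) hne
  | step p v hp ih =>
    have h1 := (hp.anc_iff.1 h).resolve_left hne
    by_cases hxp : x = p
    · exact ⟨v, hxp ▸ hp, C.anc_refl v⟩
    · obtain ⟨a, ha, hap⟩ := ih h1 hxp
      exact ⟨a, ha, hap.trans hp.anc⟩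

theorem Anc.exists_walk {x y : C.V} (h : C.Anc x y) :
    ∃ p : C.graph.Walk x y, ∀ z ∈ p.support, C.Anc x z ∧ C.Anc z y := by
  induction y using rootInduction with
  | root =>
    obtain rfl := C.anc_root.1 h
    exact ⟨Walk.nil, by simp [C.anc_refl]⟩
  | step p v hp ih =>
    rcases hp.anc_iff.1 h with rfl | h1
    · exact ⟨Walk.nil, by simp [C.anc_refl]⟩
    · obtain ⟨q, hq⟩ := ih h1
      refine ⟨q.concat hp.adj, fun z hz => ?_⟩
      rw [Walk.support_concat, List.mem_append, List.mem_singleton] at hz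
      rcases hz with hz | rfl
      · exact ⟨(hq z hz).1, (hq z hz).2.trans hp.anc⟩
      · exact ⟨h, C.anc_refl _⟩

/-! ### Heights -/

theorem distOf_root_root (w : Sym2 C.V → ℝ) : C.distOf w C.root C.root = 0 := C.distOf_self w _

theorem height_root : C.height C.root = 0 := C.distOf_self _ _

theorem IsParent.height_lt {p v : C.V} (h : C.IsParent p v) : C.height p < C.height v := by
  rw [height, height, h.distOf_root]
  exact lt_add_of_pos_right _ (C.len_pos _ h.adj)

theorem Anc.height_le {x y : C.V} (h : C.Anc x y) : C.height x ≤ C.height y := by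
  induction y using rootInduction with
  | root => rw [C.anc_root.1 h]
  | step p v hp ih =>
    rcases hp.anc_iff.1 h with rfl | h1
    · exact le_rfl
    · exact (ih h1).trans hp.height_lt.le

theorem Anc.height_lt {x y : C.V} (h : C.Anc x y) (hne : x ≠ y) : C.height x < C.height y := by
  obtain ⟨a, ha, hay⟩ := h.exists_child hne
  exact ha.height_lt.trans_le hay.height_le

theorem Anc.of_height_le {x y z : C.V} (hx : C.Anc x z) (hy : C.Anc y z)
    (hle : C.height x ≤ C.height y) : C.Anc x y := by
  rcases hx.total hy with h | h
  · exact h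
  · by_cases hne : y = x
    · exact hne ▸ C.anc_refl _
    · exact absurd hle (h.height_lt hne).not_ge

theorem height_nonneg (v : C.V) : 0 ≤ C.height v := by
  rw [← C.height_root]; exact (C.root_anc v).height_le

theorem height_pos {v : C.V} (hv : v ≠ C.root) : 0 < C.height v := by
  rw [← C.height_root]; exact (C.root_anc v).height_lt hv.symm

/-- Edge lengths with given distances from the root. -/
theorem distOf_root_eq {w : Sym2 C.V → ℝ} {H : C.V → ℝ} (h0 : H C.root = 0)
    (hw : ∀ p v, C.IsParent p v → w s(p, v) = H v - H p) (v : C.V) :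
    C.distOf w C.root v = H v := by
  induction v using rootInduction with
  | root => rw [distOf_root_root, h0]
  | step p v hp ih => rw [hp.distOf_root, ih, hw p v hp]; ring

/-! ### Meets -/

/-- Move `u` away from the root. As long as `u` is not on the root path of `v`, the meet of its
parent still serves, since the path from `u` to `v` starts with the edge to the parent. One meet
serves all edge lengths `w`, degenerate ones included, which is needed for whole cones. -/
theorem exists_meet (u v : C.V) : ∃ m, C.Anc m u ∧ C.Anc m v ∧
    (∀ x, C.Anc x u → C.Anc x v → C.Anc x m) ∧
    ∀ w, C.distOf w u v =
      C.distOf w C.root u + C.distOf w C.root v - 2 * C.distOf w C.root m := by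
  have base : ∀ u v, C.Anc u v → ∃ m, C.Anc m u ∧ C.Anc m v ∧
      (∀ x, C.Anc x u → C.Anc x v → C.Anc x m) ∧ ∀ w, C.distOf w u v =
      C.distOf w C.root u + C.distOf w C.root v - 2 * C.distOf w C.root m := fun u v h =>
    ⟨u, C.anc_refl u, h, fun x hx _ => hx, fun w => by
      have := C.distOf_add_of_mem w h
      linarith⟩
  induction u using rootInduction with
  | root => exact base _ _ (C.root_anc v)
  | step p u hp ih =>
    by_cases h : C.Anc u v
    · exact base _ _ h
    obtain ⟨m, h1, h2, h3, h4⟩ := ih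
    refine ⟨m, h1.trans hp.anc, h2, fun x hx hxv => h3 x ?_ hxv, fun w => ?_⟩
    · rcases hp.anc_iff.1 hx with rfl | hx
      · exact absurd hxv h
      · exact hx
    · have hnot : u ∉ (C.path p v).support := by
        intro hmem
        have := C.support_path_subset ((C.path C.root p).reverse.append (C.path C.root v)) hmem
        rw [Walk.mem_support_append_iff, Walk.support_reverse, List.mem_reverse] at this
        exact this.elim hp.notMem h
      rw [C.distOf_of_adj_of_notMem w hp.adj.symm hnot, h4, hp.distOf_root, Sym2.eq_swap]
      ring

variable (C) in
/-- The last common vertex of the paths from the root to `u` and to `v`. -/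
noncomputable def meet (u v : C.V) : C.V := (exists_meet u v).choose

theorem meet_anc_left (u v : C.V) : C.Anc (C.meet u v) u := (exists_meet u v).choose_spec.1

theorem meet_anc_right (u v : C.V) : C.Anc (C.meet u v) v := (exists_meet u v).choose_spec.2.1

theorem Anc.meet {x u v : C.V} (hu : C.Anc x u) (hv : C.Anc x v) : C.Anc x (C.meet u v) :=
  (exists_meet u v).choose_spec.2.2.1 x hu hv

theorem distOf_eq_meet (w : Sym2 C.V → ℝ) (u v : C.V) : C.distOf w u v =
    C.distOf w C.root u + C.distOf w C.root v - 2 * C.distOf w C.root (C.meet u v) :=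
  (exists_meet u v).choose_spec.2.2.2 w

theorem eq_meet_of_anc {x u v : C.V} (hu : C.Anc x u) (hv : C.Anc x v)
    (h : C.Anc (C.meet u v) x) : C.meet u v = x := h.antisymm (hu.meet hv)

theorem meet_comm (u v : C.V) : C.meet u v = C.meet v u :=
  eq_meet_of_anc (meet_anc_right v u) (meet_anc_left v u)
    ((meet_anc_right u v).meet (meet_anc_left u v))

/-! ### Stability -/

/-- Some end other than the first lies beyond each vertex. -/
theorem exists_end_anc (v : C.V) : ∃ i : Fin n, i ≠ 0 ∧ C.Anc v (C.endAt i) := by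
  -- A highest vertex beyond `v` has no neighbour except its parent, so by stability it carries two
  -- ends, one of which is not the first.
  obtain ⟨y, hy, hmax⟩ := Set.exists_max_image {y | C.Anc v y} C.height (Set.toFinite _)
    ⟨v, C.anc_refl v⟩
  have hy : C.Anc v y := hy
  have hN : (C.graph.neighborSet y).ncard ≤ 1 := by
    refine (Set.ncard_le_one (Set.toFinite _)).2 fun a ha b hb => ?_
    have key : ∀ a ∈ C.graph.neighborSet y, C.IsParent a y := by
      intro a ha
      rcases isParent_or_of_adj (C := C) ha with h | h
      · exact absurd (hmax a (hy.trans h.anc)) h.height_lt.not_ge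
      · exact h
    exact (key a ha).unique (key b hb)
  have h2 : 1 < {i | C.endAt i = y}.ncard := by have := C.stable y; omega
  obtain ⟨a, ha, ha0⟩ := Set.exists_ne_of_one_lt_ncard h2 (0 : Fin n)
  have ha : C.endAt a = y := ha
  exact ⟨a, ha0, ha ▸ hy⟩

/-- Every vertex below an end `i` is the meet of that end with another one. -/
theorem exists_meet_eq {v : C.V} {i : Fin n} (hi0 : i ≠ 0) (hi : C.Anc v (C.endAt i)) :
    ∃ j, j ≠ 0 ∧ j ≠ i ∧ C.meet (C.endAt i) (C.endAt j) = v := by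
  -- Otherwise every other end beyond `v` parts from `i` strictly beyond `v`. Then all of them leave
  -- `v` in one direction, and the valence of `v` is at most `2`.
  by_contra! hcon
  have hend : ∀ j, j ≠ 0 → j ≠ i → C.Anc v (C.endAt j) →
      C.Anc v (C.meet (C.endAt i) (C.endAt j)) ∧ v ≠ C.meet (C.endAt i) (C.endAt j) :=
    fun j h0 hj h => ⟨hi.meet h, (hcon j h0 hj).symm⟩
  -- neighbours other than the parent, and ends other than the first
  have hsplit : (C.graph.neighborSet v).ncard + {j | C.endAt j = v}.ncard ≤
      {a | C.IsParent v a}.ncard + {j | j ≠ 0 ∧ C.endAt j = v}.ncard + 1 := by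
    by_cases hv : v = C.root
    · have h1 : C.graph.neighborSet v ⊆ {a | C.IsParent v a} := fun a ha =>
        (isParent_or_of_adj (C := C) ha).resolve_right fun h => not_isParent_root a (hv ▸ h)
      have h2 : {j | C.endAt j = v} ⊆ insert 0 {j | j ≠ 0 ∧ C.endAt j = v} := fun j hj => by
        by_cases h : j = 0
        · exact Or.inl h
        · exact Or.inr ⟨h, hj⟩
      have := Set.ncard_le_ncard h1 (Set.toFinite _)
      have := Set.ncard_le_ncard h2 (Set.toFinite _)
      have := Set.ncard_insert_le (0 : Fin n) {j | j ≠ 0 ∧ C.endAt j = v}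
      omega
    · obtain ⟨p, hp⟩ := exists_isParent hv
      have h1 : C.graph.neighborSet v ⊆ insert p {a | C.IsParent v a} := fun a ha =>
        (isParent_or_of_adj (C := C) ha).symm.imp (fun h => h.unique hp) id
      have h2 : {j | C.endAt j = v} ⊆ {j | j ≠ 0 ∧ C.endAt j = v} := fun j hj =>
        ⟨fun h => hv (by rw [← (hj : C.endAt j = v), h]; rfl), hj⟩
      have := Set.ncard_le_ncard h1 (Set.toFinite _)
      have := Set.ncard_le_ncard h2 (Set.toFinite _)
      have := Set.ncard_insert_le p {a | C.IsParent v a}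
      omega
  -- If `i` is attached at `v`, it is the only such end and `v` has no child; if not, the child
  -- towards `i` is the only one and no end besides possibly the first is attached.
  have hle : {a | C.IsParent v a}.ncard + {j | j ≠ 0 ∧ C.endAt j = v}.ncard ≤ 1 := by
    by_cases hv : C.endAt i = v
    · have h1 : {a | C.IsParent v a} = ∅ := by
        refine Set.eq_empty_iff_forall_notMem.2 fun a (ha : C.IsParent v a) => ?_
        obtain ⟨j, hj0, hj⟩ := exists_end_anc a
        have hji : j ≠ i := by
          rintro rfl
          exact ha.notMem (hv ▸ hj)
        have hm := hend j hj0 hji (ha.anc.trans hj)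
        refine hm.2 (hm.1.antisymm ?_)
        rw [← hv]
        exact meet_anc_left _ _
      have h2 : {j | j ≠ 0 ∧ C.endAt j = v} ⊆ {i} := by
        rintro j ⟨hj0, hj⟩
        by_contra hji
        have h := hend j hj0 hji (hj ▸ C.anc_refl _)
        exact h.2 (h.1.antisymm (by rw [← hj]; exact meet_anc_right _ _))
      have := Set.ncard_le_ncard h2 (Set.toFinite _)
      rw [Set.ncard_singleton] at this
      rw [h1, Set.ncard_empty]
      omega
    · obtain ⟨a, ha, hai⟩ := hi.exists_child (Ne.symm hv)
      have key : ∀ j, j ≠ 0 → C.Anc v (C.endAt j) → C.Anc a (C.endAt j) := by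
        intro j hj0 hj
        by_cases hji : j = i
        · exact hji ▸ hai
        obtain ⟨h1, h2⟩ := hend j hj0 hji hj
        obtain ⟨b, hb, hbm⟩ := h1.exists_child h2
        have : a = b := by
          rcases hai.total (hbm.trans (meet_anc_left _ _)) with h | h
          · exact ((hb.anc_iff.1 h).resolve_right ha.notMem)
          · exact ((ha.anc_iff.1 h).resolve_right hb.notMem).symm
        rw [this]
        exact hbm.trans (meet_anc_right _ _)
      have h1 : {a | C.IsParent v a} ⊆ {a} := by
        intro b (hb : C.IsParent v b)
        obtain ⟨j, hj0, hj⟩ := exists_end_anc b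
        rcases hj.total (key j hj0 (hb.anc.trans hj)) with h | h
        · exact ((ha.anc_iff.1 h).resolve_right hb.notMem)
        · exact ((hb.anc_iff.1 h).resolve_right ha.notMem).symm
      have h2 : {j | j ≠ 0 ∧ C.endAt j = v} = ∅ := by
        refine Set.eq_empty_iff_forall_notMem.2 fun j ⟨hj0, hj⟩ => ?_
        have := key j hj0 (hj ▸ C.anc_refl _)
        exact ha.notMem (hj ▸ this)
      have := Set.ncard_le_ncard h1 (Set.toFinite _)
      rw [Set.ncard_singleton] at this
      rw [h2, Set.ncard_empty]
      omega
  have := C.stable v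
  omega

end TropicalCurve

namespace TropicalCurve

open SimpleGraph

variable {n : ℕ} [NeZero n] (C : TropicalCurve n)

/-! ### The vertex at which the paths to two ends part -/

/-- The vertex at which the paths from the root to two ends part. -/
noncomputable def endMeet (e : Sym2 {i : Fin n // i ≠ 0}) : C.V :=
  Sym2.lift ⟨fun i j : {i : Fin n // i ≠ 0} => C.meet (C.endAt i) (C.endAt j),
    fun _ _ => meet_comm _ _⟩ e

variable {C}

theorem endMeet_mk (i j : {i : Fin n // i ≠ 0}) :
    C.endMeet s(i, j) = C.meet (C.endAt i) (C.endAt j) := rfl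

theorem mk_mem_completeMatroid {i j : {i : Fin n // i ≠ 0}} (h : i ≠ j) :
    s(i, j) ∈ (completeMatroid n).E := by
  rw [cycleMatroid_E]; simpa using h

theorem ne_of_mem_completeMatroid {i j : {i : Fin n // i ≠ 0}}
    (h : s(i, j) ∈ (completeMatroid n).E) : i ≠ j := by
  rw [cycleMatroid_E] at h; simpa using h

theorem exists_endMeet_eq_of_anc {v : C.V} (i : {i : Fin n // i ≠ 0}) (h : C.Anc v (C.endAt i)) :
    ∃ j, i ≠ j ∧ C.endMeet s(i, j) = v := by
  obtain ⟨j, hj0, hji, hj⟩ := exists_meet_eq i.2 h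
  exact ⟨⟨j, hj0⟩, fun h => hji (congrArg Subtype.val h).symm, hj⟩

theorem exists_end_anc' (v : C.V) : ∃ i : {i : Fin n // i ≠ 0}, C.Anc v (C.endAt i) := by
  obtain ⟨i, hi0, hi⟩ := exists_end_anc v
  exact ⟨⟨i, hi0⟩, hi⟩

/-- This makes it possible to replace vertices by pairs of ends, which two different curves have in
common. -/
theorem exists_endMeet_eq (v : C.V) : ∃ e : (completeMatroid n).E, C.endMeet e = v := by
  obtain ⟨i, hi⟩ := exists_end_anc' v
  obtain ⟨j, hij, hj⟩ := exists_endMeet_eq_of_anc i hi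
  exact ⟨⟨s(i, j), mk_mem_completeMatroid hij⟩, hj⟩

/-! ### The flats of a curve -/

/-- A walk in a rooted tree passes through a common ancestor of its two ends; the induction keeps
track of it. -/
theorem exists_common_anc_of_walk {t : ℝ} {a b : C.V} (p : C.graph.Walk a b)
    (hp : ∀ v ∈ p.support, t ≤ C.height v) : ∃ z, C.Anc z a ∧ C.Anc z b ∧ t ≤ C.height z := by
  induction p with
  | nil => exact ⟨_, C.anc_refl _, C.anc_refl _, hp _ (by simp)⟩
  | @cons a a' b h p ih =>
    obtain ⟨z, hz1, hz2, hz3⟩ := ih fun v hv => hp v (by simp [hv])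
    rcases isParent_or_of_adj h with hpar | hpar
    · rcases hpar.anc_iff.1 hz1 with rfl | hz
      · exact ⟨a, C.anc_refl a, hpar.anc.trans hz2, hp a (by simp)⟩
      · exact ⟨z, hz, hz2, hz3⟩
    · exact ⟨z, hz1.trans hpar.anc, hz2, hz3⟩

theorem exists_walk_iff {t : ℝ} {a b : C.V} :
    (∃ p : C.graph.Walk a b, ∀ v ∈ p.support, t ≤ C.height v) ↔ t ≤ C.height (C.meet a b) := by
  constructor
  · rintro ⟨p, hp⟩
    obtain ⟨z, h1, h2, h3⟩ := exists_common_anc_of_walk p hp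
    exact h3.trans (h1.meet h2).height_le
  · intro h
    obtain ⟨p, hp⟩ := (meet_anc_left (C := C) a b).exists_walk
    obtain ⟨q, hq⟩ := (meet_anc_right (C := C) a b).exists_walk
    refine ⟨p.reverse.append q, fun v hv => ?_⟩
    rw [Walk.mem_support_append_iff, Walk.support_reverse, List.mem_reverse] at hv
    rcases hv with hv | hv
    · exact h.trans (hp v hv).1.height_le
    · exact h.trans (hq v hv).1.height_le

theorem mem_levelFlat_iff {t : ℝ} {e : Sym2 {i : Fin n // i ≠ 0}} :
    e ∈ C.levelFlat t ↔ e ∈ (completeMatroid n).E ∧ t ≤ C.height (C.endMeet e) := by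
  constructor
  · rintro ⟨i, j, hij, rfl, h⟩
    exact ⟨mk_mem_completeMatroid hij, exists_walk_iff.1 h⟩
  · rintro ⟨he, h⟩
    induction e with
    | _ i j => exact ⟨i, j, ne_of_mem_completeMatroid he, rfl, exists_walk_iff.2 h⟩

theorem isFlat_levelFlat (t : ℝ) : (completeMatroid n).IsFlat (C.levelFlat t) := by
  refine Matroid.cycleMatroid_top_isFlat_iff.2 ⟨fun e he => (mem_levelFlat_iff.1 he).1, ?_⟩
  intro i j k hik hij hjk
  refine mem_levelFlat_iff.2 ⟨mk_mem_completeMatroid hik, ?_⟩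
  have h1 := exists_walk_iff.2 (mem_levelFlat_iff.1 hij).2
  have h2 := exists_walk_iff.2 (mem_levelFlat_iff.1 hjk).2
  obtain ⟨p, hp⟩ := h1
  obtain ⟨q, hq⟩ := h2
  refine exists_walk_iff.1 ⟨p.append q, fun v hv => ?_⟩
  rw [Walk.mem_support_append_iff] at hv
  exact hv.elim (hp v) (hq v)

variable (C) in
/-- The chain of flats of a curve. -/
def levelChain : (completeMatroid n).ChainOfFlats :=
  ⟨C.levelFlats, by
    rintro _ ⟨u, -, rfl⟩ _ ⟨v, -, rfl⟩ -
    rcases le_total (C.height u) (C.height v) with h | h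
    · exact Or.inr fun e he => mem_levelFlat_iff.2 ((mem_levelFlat_iff.1 he).imp_right h.trans)
    · exact Or.inl fun e he => mem_levelFlat_iff.2 ((mem_levelFlat_iff.1 he).imp_right h.trans), by
    rintro _ ⟨v, hv, rfl⟩
    refine ⟨isFlat_levelFlat _, ?_, fun h => ?_⟩
    · obtain ⟨e, he⟩ := exists_endMeet_eq v
      exact ⟨e, mem_levelFlat_iff.2 ⟨e.2, he ▸ le_rfl⟩⟩
    -- A pair of ends that part at the root has height `0`, so it is missing from every flat of
    -- positive level.
    · obtain ⟨e, he⟩ := exists_endMeet_eq C.root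
      have := (mem_levelFlat_iff.1 (h.symm.subset e.2)).2
      rw [he, height_root] at this
      exact (height_pos hv).not_ge this⟩

/-- The preorder on pairs of ends given by the flats of a curve. -/
theorem forall_mem_levelFlats_iff {e e' : (completeMatroid n).E} :
    (∀ F ∈ C.levelFlats, (e' : Sym2 {i : Fin n // i ≠ 0}) ∈ F → (e : Sym2 _) ∈ F) ↔
      C.height (C.endMeet e') ≤ C.height (C.endMeet e) := by
  constructor
  · intro h
    by_cases hr : C.endMeet e' = C.root
    · rw [hr, height_root]
      exact height_nonneg _
    · exact (mem_levelFlat_iff.1 (h _ ⟨_, hr, rfl⟩ (mem_levelFlat_iff.2 ⟨e'.2, le_rfl⟩))).2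
  · rintro h _ ⟨v, -, rfl⟩ he'
    exact mem_levelFlat_iff.2 ⟨e.2, (mem_levelFlat_iff.1 he').2.trans h⟩

theorem monotoneAlong_levelFlats {x : (completeMatroid n).E → ℝ} :
    (completeMatroid n).MonotoneAlong C.levelFlats x ↔ ∀ e e' : (completeMatroid n).E,
      C.height (C.endMeet e') ≤ C.height (C.endMeet e) → x e ≤ x e' :=
  forall₂_congr fun _ _ => by rw [forall_mem_levelFlats_iff]

theorem monotoneAlong_neg_height :
    (completeMatroid n).MonotoneAlong C.levelFlats fun e => -C.height (C.endMeet e) :=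
  monotoneAlong_levelFlats.2 fun _ _ h => neg_le_neg h

/-- Inclusion of the flats of two curves, in terms of the orderings of their vertices. -/
theorem levelFlats_subset_iff {C' : TropicalCurve n} : C.levelFlats ⊆ C'.levelFlats ↔
    ∀ e e' : (completeMatroid n).E, C'.height (C'.endMeet e') ≤ C'.height (C'.endMeet e) →
      C.height (C.endMeet e') ≤ C.height (C.endMeet e) := by
  constructor
  · intro h e e' hle
    have := monotoneAlong_levelFlats.1 (monotoneAlong_neg_height.mono h) e e' hle
    exact neg_le_neg_iff.1 this
  · rintro h _ ⟨v, hv, rfl⟩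
    obtain ⟨e₀, he₀⟩ := exists_endMeet_eq v
    -- Among the pairs that part at level at least `height v` in `C`, take one that parts lowest in
    -- `C'`; its level in `C'` cuts out the same flat.
    obtain ⟨e, he, hmin⟩ := Set.exists_min_image
      {e : (completeMatroid n).E | C.height v ≤ C.height (C.endMeet e)}
      (fun e => C'.height (C'.endMeet e)) (Set.toFinite _)
      ⟨e₀, (he₀ ▸ le_rfl : C.height v ≤ C.height (C.endMeet e₀))⟩
    have he : C.height v ≤ C.height (C.endMeet e) := he
    refine ⟨C'.endMeet e, fun hr => ?_, ?_⟩
    · obtain ⟨e₁, he₁⟩ := exists_endMeet_eq C.root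
      have := he.trans (h e₁ e (by rw [hr, height_root]; exact height_nonneg _))
      rw [he₁, height_root] at this
      exact (height_pos hv).not_ge this
    · ext f
      rw [mem_levelFlat_iff, mem_levelFlat_iff]
      refine and_congr_right fun hf => ⟨fun h1 => hmin ⟨f, hf⟩ h1, fun h1 => ?_⟩
      exact he.trans (h ⟨f, hf⟩ e h1)

end TropicalCurve

namespace TropicalCurve

open SimpleGraph

variable {n : ℕ} [NeZero n] {C C' : TropicalCurve n}

/-! ### The contraction given by an inclusion of chains of flats -/

theorem endMeet_anc_left (i j : {i : Fin n // i ≠ 0}) : C.Anc (C.endMeet s(i, j)) (C.endAt i) :=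
  meet_anc_left _ _

theorem endMeet_anc_right (i j : {i : Fin n // i ≠ 0}) : C.Anc (C.endMeet s(i, j)) (C.endAt j) :=
  meet_anc_right _ _

/-- If `k` lies beyond the meet of `i` and `j` in `C'`, then `i` and `k` part no lower than `i` and
`j` do. This comparison of levels passes to `C`, where both meets lie on the root path of `i` and
are therefore ordered by height. -/
theorem endMeet_anc_of_levelFlats_subset (h : C.levelFlats ⊆ C'.levelFlats)
    (e : (completeMatroid n).E) {k : {i : Fin n // i ≠ 0}}
    (hk : C'.Anc (C'.endMeet e) (C'.endAt k)) : C.Anc (C.endMeet e) (C.endAt k) := by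
  obtain ⟨e, he⟩ := e
  induction e with
  | _ i j =>
    by_cases hik : i = k
    · subst hik
      exact endMeet_anc_left _ _
    · have h1 : C'.Anc (C'.endMeet s(i, j)) (C'.endMeet s(i, k)) := (endMeet_anc_left i j).meet hk
      have h2 := levelFlats_subset_iff.1 h ⟨s(i, k), mk_mem_completeMatroid hik⟩ ⟨s(i, j), he⟩
        h1.height_le
      exact ((endMeet_anc_left i j).of_height_le (endMeet_anc_left i k) h2).trans
        (endMeet_anc_right i k)

theorem endMeet_anc_endMeet_of_levelFlats_subset (h : C.levelFlats ⊆ C'.levelFlats)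
    (e f : (completeMatroid n).E) (hef : C'.Anc (C'.endMeet e) (C'.endMeet f)) :
    C.Anc (C.endMeet e) (C.endMeet f) := by
  have hle := levelFlats_subset_iff.1 h f e hef.height_le
  obtain ⟨f, hf⟩ := f
  induction f with
  | _ i j =>
    exact (endMeet_anc_of_levelFlats_subset h e (hef.trans (endMeet_anc_left i j))).of_height_le
      (endMeet_anc_left i j) hle

variable (C C') in
/-- The vertex of `C` corresponding to a vertex of `C'` if the flats of `C` are among those
of `C'`. -/
noncomputable def contraction (v : C'.V) : C.V := C.endMeet (exists_endMeet_eq v).choose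

/-- The image does not depend on the chosen pair: two pairs with the same meet in `C'` have meets in
`C` that are ancestors of each other. -/
theorem contraction_endMeet (h : C.levelFlats ⊆ C'.levelFlats) (e : (completeMatroid n).E) :
    contraction C C' (C'.endMeet e) = C.endMeet e := by
  have hs := (exists_endMeet_eq (C'.endMeet e)).choose_spec
  exact (endMeet_anc_endMeet_of_levelFlats_subset h _ _ (by rw [hs]; exact C'.anc_refl _)).antisymm
    (endMeet_anc_endMeet_of_levelFlats_subset h _ _ (by rw [hs]; exact C'.anc_refl _))

theorem contraction_surjective (h : C.levelFlats ⊆ C'.levelFlats) :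
    Function.Surjective (contraction C C') := fun x => by
  obtain ⟨e, rfl⟩ := exists_endMeet_eq x
  exact ⟨_, contraction_endMeet h e⟩

theorem contraction_anc (h : C.levelFlats ⊆ C'.levelFlats) {u v : C'.V} (huv : C'.Anc u v) :
    C.Anc (contraction C C' u) (contraction C C' v) := by
  obtain ⟨e, rfl⟩ := exists_endMeet_eq u
  obtain ⟨f, rfl⟩ := exists_endMeet_eq v
  rw [contraction_endMeet h, contraction_endMeet h]
  exact endMeet_anc_endMeet_of_levelFlats_subset h e f huv

theorem contraction_anc_endAt (h : C.levelFlats ⊆ C'.levelFlats) {v : C'.V}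
    {i : {i : Fin n // i ≠ 0}} (hv : C'.Anc v (C'.endAt i)) :
    C.Anc (contraction C C' v) (C.endAt i) := by
  obtain ⟨e, rfl⟩ := exists_endMeet_eq v
  rw [contraction_endMeet h]
  exact endMeet_anc_of_levelFlats_subset h e hv

theorem contraction_height (h : C.levelFlats ⊆ C'.levelFlats) {u v : C'.V}
    (huv : C'.height u ≤ C'.height v) :
    C.height (contraction C C' u) ≤ C.height (contraction C C' v) := by
  obtain ⟨e, rfl⟩ := exists_endMeet_eq u
  obtain ⟨f, rfl⟩ := exists_endMeet_eq v
  rw [contraction_endMeet h, contraction_endMeet h]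
  exact levelFlats_subset_iff.1 h f e huv

theorem contraction_endAt (h : C.levelFlats ⊆ C'.levelFlats) (i : Fin n) :
    contraction C C' (C'.endAt i) = C.endAt i := by
  by_cases hi : i = 0
  · subst hi
    obtain ⟨e, he⟩ := exists_endMeet_eq C.root
    have := contraction_anc h (C'.root_anc (C'.endMeet e))
    rw [contraction_endMeet h, he, anc_root] at this
    exact this
  · obtain ⟨j, hij, hj⟩ := exists_endMeet_eq_of_anc ⟨i, hi⟩ (C'.anc_refl (C'.endAt i))
    obtain ⟨k, hik, hk⟩ := exists_endMeet_eq_of_anc ⟨i, hi⟩ (C.anc_refl (C.endAt i))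
    refine Anc.antisymm (contraction_anc_endAt (i := ⟨i, hi⟩) h (C'.anc_refl _)) ?_
    rw [← hk, ← contraction_endMeet h ⟨_, mk_mem_completeMatroid hik⟩]
    exact contraction_anc h (endMeet_anc_left ⟨i, hi⟩ k)

/-- If the images differ, the child `a` of the image of `u` towards that of `v` is the meet in `C`
of an end `i` beyond `v` and some end `k`. The meet of `i` and `k` in `C'` is not an ancestor of
`u`, since `a` is not one of the image of `u`; so it is `v` or lies beyond `v`, which forces `a` to
be the image of `v`. -/
theorem contraction_isParent (h : C.levelFlats ⊆ C'.levelFlats) {u v : C'.V}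
    (huv : C'.IsParent u v) : contraction C C' u = contraction C C' v ∨
      C.IsParent (contraction C C' u) (contraction C C' v) := by
  by_cases hne : contraction C C' u = contraction C C' v
  · exact Or.inl hne
  right
  obtain ⟨a, ha, hav⟩ := (contraction_anc h huv.anc).exists_child hne
  suffices a = contraction C C' v from this ▸ ha
  obtain ⟨i, hi⟩ := exists_end_anc' v
  obtain ⟨k, hik, rfl⟩ := exists_endMeet_eq_of_anc i (hav.trans (contraction_anc_endAt h hi))
  have hc := contraction_endMeet h ⟨_, mk_mem_completeMatroid hik⟩
  simp only at hc
  rcases hi.total (endMeet_anc_left i k) with hy | hy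
  · have := contraction_anc h hy
    rw [hc] at this
    exact hav.antisymm this
  · rcases huv.anc_iff.1 hy with hy | hy
    · rw [← hc, hy]
    · have := contraction_anc h hy
      rw [hc] at this
      exact absurd this ha.notMem

theorem contraction_adj (h : C.levelFlats ⊆ C'.levelFlats) {u v : C'.V}
    (huv : C'.graph.Adj u v) : contraction C C' u = contraction C C' v ∨
      C.graph.Adj (contraction C C' u) (contraction C C' v) := by
  rcases isParent_or_of_adj huv with hp | hp
  · exact (contraction_isParent h hp).imp_right IsParent.adj
  · exact (contraction_isParent h hp).imp Eq.symm fun h => h.adj.symm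

/-- For incomparable `u` and `v`, the meet is that of two ends `i` and `j` beyond them. The common
image is an ancestor of `i` and `j` in `C`, hence of their meet. This makes the fibres connected. -/
theorem contraction_meet (h : C.levelFlats ⊆ C'.levelFlats) {u v : C'.V}
    (huv : contraction C C' u = contraction C C' v) :
    contraction C C' (C'.meet u v) = contraction C C' u := by
  rcases Classical.em (C'.Anc u v) with hc | hc
  · rw [eq_meet_of_anc (C'.anc_refl u) hc (meet_anc_left _ _)]
  rcases Classical.em (C'.Anc v u) with hc' | hc'
  · rw [eq_meet_of_anc hc' (C'.anc_refl v) (meet_anc_right _ _), huv]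
  refine (contraction_anc h (meet_anc_left u v)).antisymm ?_
  obtain ⟨i, hi⟩ := exists_end_anc' u
  obtain ⟨j, hj⟩ := exists_end_anc' v
  have hm : C'.endMeet s(i, j) = C'.meet u v := by
    refine eq_meet_of_anc ((meet_anc_left _ _).trans hi) ((meet_anc_right _ _).trans hj) ?_
    refine Anc.meet ?_ ?_
    · rcases hi.total (endMeet_anc_left i j) with h1 | h1
      · rcases hj.total (h1.trans (endMeet_anc_right i j)) with h2 | h2
        · exact absurd h2 hc'
        · exact absurd h2 hc
      · exact h1
    · rcases hj.total (endMeet_anc_right i j) with h1 | h1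
      · rcases hi.total (h1.trans (endMeet_anc_left i j)) with h2 | h2
        · exact absurd h2 hc
        · exact absurd h2 hc'
      · exact h1
  have hij : i ≠ j := by
    rintro rfl
    exact (hi.total hj).elim hc hc'
  rw [← hm, contraction_endMeet h ⟨_, mk_mem_completeMatroid hij⟩]
  exact (contraction_anc_endAt h hi).meet (huv ▸ contraction_anc_endAt h hj)

theorem contraction_connected (h : C.levelFlats ⊆ C'.levelFlats) (x : C.V) :
    (C'.graph.induce (contraction C C' ⁻¹' {x})).Connected := by
  have key : ∀ (u m : C'.V) (hu : u ∈ contraction C C' ⁻¹' {x})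
      (hm : m ∈ contraction C C' ⁻¹' {x}), C'.Anc m u →
      (C'.graph.induce (contraction C C' ⁻¹' {x})).Reachable ⟨m, hm⟩ ⟨u, hu⟩ := by
    intro u m hu hm hmu
    obtain ⟨p, hp⟩ := hmu.exists_walk
    refine ⟨p.induce _ fun z hz => ?_⟩
    have h1 := contraction_anc h (hp z hz).1
    have h2 := contraction_anc h (hp z hz).2
    rw [Set.mem_preimage, Set.mem_singleton_iff] at hu hm ⊢
    rw [hm] at h1
    rw [hu] at h2
    exact h2.antisymm h1
  obtain ⟨y, hy⟩ := contraction_surjective h x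
  have : Nonempty ↑(contraction C C' ⁻¹' {x}) := ⟨⟨y, hy⟩⟩
  refine ⟨fun ⟨u, hu⟩ ⟨v, hv⟩ => ?_⟩
  rw [Set.mem_preimage, Set.mem_singleton_iff] at hu hv
  have hm : C'.meet u v ∈ contraction C C' ⁻¹' {x} :=
    (contraction_meet h (hu.trans hv.symm)).trans hu
  exact (key u _ hu hm (meet_anc_left u v)).symm.trans (key v _ hv hm (meet_anc_right u v))

theorem isFaceOf_of_levelFlats_subset (h : C.levelFlats ⊆ C'.levelFlats) : C.IsFaceOf C' :=
  ⟨contraction C C', contraction_surjective h, contraction_endAt h,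
    fun _ _ => contraction_adj h, contraction_connected h, fun _ _ => contraction_height h⟩

/-! ### The flats of a face -/

/-- Every edge of a tree is a bridge. If no edge of `G` mapped onto `xy`, the connected graph `G`
would map into the tree without `xy` and still reach both sides. -/
theorem exists_adj_lift {V W : Type*} {G : SimpleGraph V} {T : SimpleGraph W} (hT : T.IsTree)
    (hG : G.Connected) {c : V → W} (hc : Function.Surjective c)
    (hadj : ∀ u v, G.Adj u v → c u = c v ∨ T.Adj (c u) (c v)) {x y : W} (hxy : T.Adj x y) :
    ∃ u v, G.Adj u v ∧ c u = x ∧ c v = y := by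
  classical
  by_contra! hcon
  have hb := isAcyclic_iff_forall_adj_isBridge.1 hT.isAcyclic hxy
  rw [isBridge_iff] at hb
  have key : ∀ u v, G.Reachable u v → (T.deleteEdges {s(x, y)}).Reachable (c u) (c v) := by
    rintro u v ⟨p⟩
    induction p with
    | nil => exact Reachable.refl _
    | @cons a b d hab p ih =>
      refine Reachable.trans ?_ ih
      rcases hadj a b hab with h | h
      · rw [h]
      · refine Adj.reachable ?_
        rw [deleteEdges_adj, Set.mem_singleton_iff, Sym2.eq_iff]
        refine ⟨h, ?_⟩
        rintro (⟨h1, h2⟩ | ⟨h1, h2⟩)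
        · exact hcon a b hab h1 h2
        · exact hcon b a hab.symm h2 h1
  obtain ⟨u, rfl⟩ := hc x
  obtain ⟨v, rfl⟩ := hc y
  exact hb (key u v (hG.preconnected u v))

theorem exists_walk_lift {V W : Type*} {G : SimpleGraph V} {T : SimpleGraph W} (hT : T.IsTree)
    (hG : G.Connected) {c : V → W} (hc : Function.Surjective c)
    (hadj : ∀ u v, G.Adj u v → c u = c v ∨ T.Adj (c u) (c v))
    (hconn : ∀ x, (G.induce (c ⁻¹' {x})).Connected) {x y : W} (p : T.Walk x y) :
    ∀ u v, c u = x → c v = y → ∃ q : G.Walk u v, ∀ z ∈ q.support, c z ∈ p.support := by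
  have fibre : ∀ x u v, c u = x → c v = x → ∃ q : G.Walk u v, ∀ z ∈ q.support, c z = x := by
    intro x u v hu hv
    obtain ⟨q⟩ := (hconn x).preconnected ⟨u, hu⟩ ⟨v, hv⟩
    refine ⟨q.map (Embedding.induce (c ⁻¹' {x})).toHom, fun z hz => ?_⟩
    have hz' : z ∈ q.support.map (Embedding.induce (G := G) (c ⁻¹' {x})).toHom := by
      rw [← Walk.support_map]; exact hz
    obtain ⟨a, -, rfl⟩ := List.mem_map.1 hz'
    exact a.2
  induction p with
  | nil =>
    intro u v hu hv
    obtain ⟨q, hq⟩ := fibre _ u v hu hv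
    exact ⟨q, fun z hz => by simp [hq z hz]⟩
  | @cons x x' y hxx' p ih =>
    intro u v hu hv
    obtain ⟨a, b, hab, ha, hb⟩ := exists_adj_lift hT hG hc hadj hxx'
    obtain ⟨q₁, hq₁⟩ := fibre x u a hu ha
    obtain ⟨q₂, hq₂⟩ := ih b v hb hv
    refine ⟨q₁.append (Walk.cons hab q₂), fun z hz => ?_⟩
    rw [Walk.mem_support_append_iff, Walk.support_cons, List.mem_cons] at hz
    rw [Walk.support_cons, List.mem_cons]
    rcases hz with hz | rfl | hz
    · exact Or.inl (hq₁ z hz)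
    · exact Or.inl ha
    · exact Or.inr (hq₂ z hz)

theorem exists_walk_image {V W : Type*} {G : SimpleGraph V} {T : SimpleGraph W} {c : V → W}
    (hadj : ∀ u v, G.Adj u v → c u = c v ∨ T.Adj (c u) (c v)) {u v : V} (p : G.Walk u v) :
    ∃ q : T.Walk (c u) (c v), ∀ z ∈ q.support, ∃ y ∈ p.support, c y = z := by
  induction p with
  | nil => exact ⟨Walk.nil, by simp⟩
  | @cons a b d hab p ih =>
    obtain ⟨q, hq⟩ := ih
    rcases hadj a b hab with h | h
    · refine ⟨q.copy h.symm rfl, fun z hz => ?_⟩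
      rw [Walk.support_copy] at hz
      obtain ⟨y, hy, hyz⟩ := hq z hz
      exact ⟨y, by simp [hy], hyz⟩
    · refine ⟨Walk.cons h q, fun z hz => ?_⟩
      rw [Walk.support_cons, List.mem_cons] at hz
      rcases hz with rfl | hz
      · exact ⟨a, by simp, rfl⟩
      · obtain ⟨y, hy, hyz⟩ := hq z hz
        exact ⟨y, by simp [hy], hyz⟩

/-- Let `v` be a lowest vertex of `C'` whose image is at least as high as `x`. The vertices at least
as high as `v` are then exactly those with image at least as high as `x`. Walks above these levels
project along the contraction, and lift because its fibres are connected. -/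
theorem IsFaceOf.levelFlats_subset (h : C.IsFaceOf C') : C.levelFlats ⊆ C'.levelFlats := by
  obtain ⟨c, hc, hend, hadj, hconn, hmono⟩ := h
  rintro _ ⟨x, hx, rfl⟩
  obtain ⟨v₀, hv₀⟩ := hc x
  obtain ⟨v, hv, hmin⟩ := Set.exists_min_image {v | C.height x ≤ C.height (c v)} C'.height
    (Set.toFinite _) ⟨v₀, (hv₀ ▸ le_rfl : C.height x ≤ C.height (c v₀))⟩
  have hv : C.height x ≤ C.height (c v) := hv
  have hiff : ∀ u, C'.height v ≤ C'.height u ↔ C.height x ≤ C.height (c u) := fun u =>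
    ⟨fun h => hv.trans (hmono v u h), fun h => hmin u h⟩
  refine ⟨v, ?_, ?_⟩
  · rintro rfl
    have : c C'.root = C.root := hend 0
    rw [this, height_root] at hv
    exact (height_pos hx).not_ge hv
  · ext e
    refine exists_congr fun i => exists_congr fun j => and_congr_right fun _ =>
      and_congr_right fun _ => ⟨?_, ?_⟩
    · rintro ⟨p, hp⟩
      obtain ⟨q, hq⟩ := exists_walk_lift C.isTree C'.isTree.connected hc hadj hconn p _ _
        (hend i) (hend j)
      exact ⟨q, fun z hz => (hiff z).2 (hp _ (hq z hz))⟩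
    · rintro ⟨p, hp⟩
      obtain ⟨q, hq⟩ := exists_walk_image hadj p
      refine ⟨q.copy (hend i) (hend j), fun z hz => ?_⟩
      rw [Walk.support_copy] at hz
      obtain ⟨y, hy, rfl⟩ := hq z hz
      exact (hiff y).1 (hp y hy)

theorem levelFlats_subset_iff_isFaceOf : C.levelFlats ⊆ C'.levelFlats ↔ C.IsFaceOf C' :=
  ⟨isFaceOf_of_levelFlats_subset, IsFaceOf.levelFlats_subset⟩

/-! ### Curves with the same flats -/

theorem contraction_contraction (h : C.levelFlats = C'.levelFlats) (v : C'.V) :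
    contraction C' C (contraction C C' v) = v := by
  obtain ⟨e, rfl⟩ := exists_endMeet_eq v
  rw [contraction_endMeet h.subset, contraction_endMeet h.symm.subset]

/-- The isomorphism of the trees of two curves with the same flats. -/
noncomputable def levelFlatsIso (h : C.levelFlats = C'.levelFlats) : C.graph ≃g C'.graph where
  toFun := contraction C' C
  invFun := contraction C C'
  left_inv := contraction_contraction h.symm
  right_inv := contraction_contraction h
  map_rel_iff' := by
    have key : ∀ {C C' : TropicalCurve n}, C.levelFlats = C'.levelFlats → ∀ {u v : C.V},
        C.graph.Adj u v → C'.graph.Adj (contraction C' C u) (contraction C' C v) := by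
      intro C C' h u v huv
      refine (contraction_adj h.symm.subset huv).resolve_left fun heq => huv.ne ?_
      rw [← contraction_contraction h.symm u, heq, contraction_contraction h.symm]
    intro u v
    refine ⟨fun huv => ?_, key h⟩
    have := key h.symm huv
    simpa [contraction_contraction h.symm] using this

/-- An isomorphism is a contraction with one-point fibres, so each type is a face of the other.
Conversely, the contractions given by the two inclusions of flats are mutually inverse. -/
theorem sameRadialType_iff : C.SameRadialType C' ↔ C.levelFlats = C'.levelFlats := by
  constructor
  · rintro ⟨φ, hend, hle⟩
    have key : ∀ {C C' : TropicalCurve n}, C.SameRadialType C' → C.IsFaceOf C' := by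
      rintro C C' ⟨φ, hend, hle⟩
      refine ⟨φ.symm, φ.symm.surjective, fun i => by rw [← hend]; exact φ.symm_apply_apply _,
        fun u v h => Or.inr (φ.symm.map_adj_iff.2 h), fun x => ?_, fun u v h => ?_⟩
      · have hx : (φ.symm ⁻¹' {x} : Set C'.V) = {φ x} := by
          ext y
          simp only [Set.mem_preimage, Set.mem_singleton_iff]
          exact ⟨fun h => by rw [← h]; exact (φ.apply_symm_apply y).symm,
            fun h => by rw [h]; exact φ.symm_apply_apply x⟩
        rw [hx]
        exact ⟨fun a b => by rw [Subsingleton.elim a b]⟩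
      · rw [hle, φ.apply_symm_apply, φ.apply_symm_apply]
        exact h
    have hs : C.SameRadialType C' := ⟨φ, hend, hle⟩
    exact (key hs).levelFlats_subset.antisymm
      (key ((radialSetoid n).iseqv.symm hs)).levelFlats_subset
  · intro h
    refine ⟨levelFlatsIso h, contraction_endAt h.symm.subset, fun u v =>
      ⟨contraction_height h.symm.subset, fun huv => ?_⟩⟩
    have := contraction_height h.subset huv
    exact (contraction_contraction h.symm u) ▸ (contraction_contraction h.symm v) ▸ this

theorem len_eq_height_sub {p v : C.V} (h : C.IsParent p v) :
    C.len s(p, v) = C.height v - C.height p := by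
  rw [height, height, h.distOf_root]; ring

/-- A curve is determined by the heights at which the paths to its ends part. -/
theorem isom_of_height_eq
    (h : ∀ e : (completeMatroid n).E, C.height (C.endMeet e) = C'.height (C'.endMeet e)) :
    C.Isom C' := by
  have hF : C.levelFlats = C'.levelFlats :=
    (levelFlats_subset_iff.2 fun e e' hle => by rwa [h, h]).antisymm
      (levelFlats_subset_iff.2 fun e e' hle => by rwa [← h, ← h])
  have hheight : ∀ v, C'.height (contraction C' C v) = C.height v := by
    intro v
    obtain ⟨e, rfl⟩ := exists_endMeet_eq v
    rw [contraction_endMeet hF.symm.subset, h]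
  have hlen : ∀ p v, C.IsParent p v →
      C'.len s(contraction C' C p, contraction C' C v) = C.len s(p, v) := by
    intro p v hpv
    have := (contraction_isParent hF.symm.subset hpv).resolve_left fun heq => hpv.adj.ne (by
      rw [← contraction_contraction hF.symm p, heq, contraction_contraction hF.symm])
    rw [len_eq_height_sub this, len_eq_height_sub hpv, hheight, hheight]
  refine ⟨levelFlatsIso hF, contraction_endAt hF.symm.subset, fun e he => ?_⟩
  induction e with
  | _ u v =>
    rcases isParent_or_of_adj he with hp | hp
    · exact hlen u v hp
    · rw [Sym2.eq_swap]
      exact hlen v u hp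

end TropicalCurve

/-! ### The Hasse diagram of a tree order -/

namespace SimpleGraph

variable {V : Type*} [PartialOrder V] [Finite V]

theorem exists_isPath_hasse (htree : ∀ a b c : V, a ≤ b → a ≤ c → b ≤ c ∨ c ≤ b) {r : V}
    (hr : ∀ v, v ≤ r) (v : V) :
    ∃ p : (hasse V).Walk r v, p.IsPath ∧ ∀ x, x ∈ p.support ↔ v ≤ x := by
  induction v using WellFoundedGT.induction with
  | _ v ih =>
    by_cases hv : v = r
    · subst hv
      exact ⟨Walk.nil, Walk.IsPath.nil, fun x => by
        simp only [Walk.support_nil, List.mem_singleton]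
        exact ⟨fun h => h ▸ le_rfl, fun h => (hr x).antisymm h⟩⟩
    obtain ⟨b, hb, -⟩ := exists_covBy_le_of_lt (lt_of_le_of_ne (hr v) hv)
    obtain ⟨p, hp, hsupp⟩ := ih b hb.lt
    have hadj : (hasse V).Adj b v := Or.inr hb
    refine ⟨p.concat hadj, hp.concat (fun h => hb.lt.not_ge ((hsupp v).1 h)) hadj, fun x => ?_⟩
    rw [Walk.support_concat, List.mem_append, List.mem_singleton, hsupp]
    constructor
    · rintro (h | rfl)
      · exact hb.le.trans h
      · exact le_rfl
    · intro h
      by_cases hxv : x = v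
      · exact Or.inr hxv
      · rcases htree v b x hb.le h with h' | h'
        · exact Or.inl h'
        · exact Or.inl ((h'.eq_of_not_lt (hb.2 (lt_of_le_of_ne h (Ne.symm hxv)))).ge)

/-- Each edge is a bridge: once the edge from `v` to its cover is deleted, no walk leaves the
elements below `v`, because an element has at most one cover. -/
theorem isTree_hasse (htree : ∀ a b c : V, a ≤ b → a ≤ c → b ≤ c ∨ c ≤ b) {r : V}
    (hr : ∀ v, v ≤ r) : (hasse V).IsTree := by
  have : Nonempty V := ⟨r⟩
  have hreach : ∀ v, (hasse V).Reachable r v := fun v =>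
    ⟨(exists_isPath_hasse htree hr v).choose⟩
  refine ⟨⟨fun u v => (hreach u).symm.trans (hreach v)⟩, ?_⟩
  rw [isAcyclic_iff_forall_adj_isBridge]
  have key : ∀ v b : V, v ⋖ b → ¬ ((hasse V).deleteEdges {s(v, b)}).Reachable v b := by
    intro v b hvb hr
    have hinv : ∀ x y, ((hasse V).deleteEdges {s(v, b)}).Reachable x y → x ≤ v → y ≤ v := by
      rintro x y ⟨p⟩
      induction p with
      | nil => exact id
      | @cons x y z hxy p ih =>
        refine fun hx => ih ?_
        rw [deleteEdges_adj, hasse_adj] at hxy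
        obtain ⟨hxy | hxy, hne⟩ := hxy
        · rcases hx.eq_or_lt with rfl | hlt
          · exfalso
            apply hne
            have : y = b := by
              rcases htree x y b hxy.le hvb.le with h | h
              · exact h.eq_of_not_lt (hvb.2 hxy.lt)
              · exact (h.eq_of_not_lt (hxy.2 hvb.lt)).symm
            rw [this]; rfl
          · rcases htree x y v hxy.le hx with h | h
            · exact h
            · exact (h.eq_of_not_lt (hxy.2 hlt)).ge
        · exact hxy.le.trans hx
    exact hvb.lt.not_ge (hinv v b hr le_rfl)
  intro u v huv
  rw [isBridge_iff]
  rcases huv with h | h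
  · exact key u v h
  · rw [Sym2.eq_swap]
    exact fun hr => key v u h hr.symm

end SimpleGraph

/-! ### Clusters of an ultrametric weight -/

/-- A nonnegative weight on pairs, attaining `0`, with the ultrametric inequality (for the
reversed order). -/
structure IsUltraWeight {X : Type*} (g : Sym2 X → ℝ) : Prop where
  ultra : ∀ i j k, i ≠ j → j ≠ k → i ≠ k → min (g s(i, j)) (g s(j, k)) ≤ g s(i, k)
  nonneg : ∀ i j, i ≠ j → 0 ≤ g s(i, j)
  exists_zero : ∃ i j, i ≠ j ∧ g s(i, j) = 0

/-- The elements whose weight with `i` is at least `t`. -/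
def weightBall {X : Type*} (g : Sym2 X → ℝ) (i : X) (t : ℝ) : Set X := {k | k = i ∨ t ≤ g s(i, k)}

/-- The balls that have at least two elements. -/
def Cluster {X : Type*} (g : Sym2 X → ℝ) : Type _ :=
  {A : Set X // ∃ i j, i ≠ j ∧ A = weightBall g i (g s(i, j))}

namespace Cluster

variable {X : Type*} {g : Sym2 X → ℝ}

instance : PartialOrder (Cluster g) := Subtype.partialOrder _

instance [Finite X] : Finite (Cluster g) := Subtype.finite

theorem le_iff {A B : Cluster g} : A ≤ B ↔ A.1 ⊆ B.1 := Iff.rfl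

/-- The least weight of a pair in a cluster. -/
noncomputable def height (A : Cluster g) : ℝ := g s(A.2.choose, A.2.choose_spec.choose)

/-- The smallest cluster that contains `i` and `j`. -/
def ofPair (g : Sym2 X → ℝ) {i j : X} (h : i ≠ j) : Cluster g :=
  ⟨weightBall g i (g s(i, j)), i, j, h, rfl⟩

theorem left_mem_ofPair {i j : X} (h : i ≠ j) : i ∈ (ofPair g h).1 := Or.inl rfl

theorem right_mem_ofPair {i j : X} (h : i ≠ j) : j ∈ (ofPair g h).1 := Or.inr le_rfl

theorem exists_pair (A : Cluster g) :
    ∃ i ∈ A.1, ∃ j ∈ A.1, i ≠ j ∧ g s(i, j) = A.height := by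
  have h := A.2.choose_spec.choose_spec
  exact ⟨_, h.2.symm.subset (Or.inl rfl), _, h.2.symm.subset (Or.inr le_rfl), h.1, rfl⟩

end Cluster

namespace IsUltraWeight

variable {X : Type*} {g : Sym2 X → ℝ}

theorem weightBall_subset (hg : IsUltraWeight g) {i k : X} {t : ℝ} (hk : k ∈ weightBall g i t) :
    weightBall g i t ⊆ weightBall g k t := by
  intro l hl
  by_cases hlk : l = k
  · exact Or.inl hlk
  by_cases hki : k = i
  · exact hki ▸ hl
  have hk' : t ≤ g s(i, k) := hk.resolve_left hki
  rw [Sym2.eq_swap] at hk'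
  by_cases hli : l = i
  · exact Or.inr (hli ▸ hk')
  · exact Or.inr ((le_min hk' (hl.resolve_left hli)).trans
      (hg.ultra k i l hki (Ne.symm hli) (Ne.symm hlk)))

/-- As in any ultrametric space, each point of a ball is a centre of it. So clusters that share a
point are nested, and their heights decide in which order. -/
theorem weightBall_eq (hg : IsUltraWeight g) {i k : X} {t : ℝ} (hk : k ∈ weightBall g i t) :
    weightBall g k t = weightBall g i t := by
  refine (hg.weightBall_subset ?_).antisymm (hg.weightBall_subset hk)
  exact hk.imp Eq.symm fun h => by rwa [Sym2.eq_swap]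

theorem cluster_eq_weightBall (hg : IsUltraWeight g) (A : Cluster g) {k : X} (hk : k ∈ A.1) :
    A.1 = weightBall g k A.height := by
  have h := A.2.choose_spec.choose_spec
  exact h.2.trans (hg.weightBall_eq (h.2.subset hk)).symm

theorem height_le (hg : IsUltraWeight g) (A : Cluster g) {i j : X} (hi : i ∈ A.1)
    (hj : j ∈ A.1) (hij : i ≠ j) : A.height ≤ g s(i, j) := by
  rw [hg.cluster_eq_weightBall A hi] at hj
  exact hj.resolve_left hij.symm

theorem height_anti (hg : IsUltraWeight g) {A B : Cluster g} (h : A ≤ B) : B.height ≤ A.height := by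
  obtain ⟨i, hi, j, hj, hij, hA⟩ := A.exists_pair
  exact hA ▸ hg.height_le B (h hi) (h hj) hij

theorem le_of_height_le (hg : IsUltraWeight g) {A B : Cluster g} {k : X} (hA : k ∈ A.1)
    (hB : k ∈ B.1) (h : B.height ≤ A.height) : A ≤ B := by
  rw [Cluster.le_iff, hg.cluster_eq_weightBall A hA, hg.cluster_eq_weightBall B hB]
  exact fun l hl => hl.imp_right h.trans

theorem height_lt (hg : IsUltraWeight g) {A B : Cluster g} (h : A < B) : B.height < A.height := by
  refine lt_of_le_of_ne (hg.height_anti h.le) fun heq => h.not_ge ?_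
  obtain ⟨i, hi, -⟩ := A.exists_pair
  exact hg.le_of_height_le (h.le hi) hi heq.ge

theorem height_ofPair (hg : IsUltraWeight g) {i j : X} (hij : i ≠ j) :
    (Cluster.ofPair g hij).height = g s(i, j) := by
  refine (hg.height_le _ (Cluster.left_mem_ofPair hij) (Cluster.right_mem_ofPair hij) hij).antisymm
    ?_
  obtain ⟨k, hk, l, hl, hkl, h⟩ := (Cluster.ofPair g hij).exists_pair
  rw [← h]
  have : l ∈ weightBall g k (g s(i, j)) := by
    rw [hg.weightBall_eq hk]
    exact hl
  exact this.resolve_left hkl.symm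

theorem total (hg : IsUltraWeight g) {A B : Cluster g} {k : X} (hA : k ∈ A.1)
    (hB : k ∈ B.1) : A ≤ B ∨ B ≤ A :=
  (le_total B.height A.height).imp (hg.le_of_height_le hA hB) (hg.le_of_height_le hB hA)

theorem treeOrder (hg : IsUltraWeight g) (A B D : Cluster g) (hB : A ≤ B) (hD : A ≤ D) :
    B ≤ D ∨ D ≤ B := by
  obtain ⟨i, hi, -⟩ := A.exists_pair
  exact hg.total (hB hi) (hD hi)

theorem ofPair_le (hg : IsUltraWeight g) {A : Cluster g} {i j : X} (hij : i ≠ j)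
    (hi : i ∈ A.1) (hj : j ∈ A.1) : Cluster.ofPair g hij ≤ A :=
  hg.le_of_height_le (Cluster.left_mem_ofPair hij) hi
    (by rw [hg.height_ofPair hij]; exact hg.height_le A hi hj hij)

theorem exists_top (hg : IsUltraWeight g) :
    ∃ R : Cluster g, R.height = 0 ∧ (∀ i, i ∈ R.1) ∧ ∀ A, A ≤ R := by
  obtain ⟨i, j, hij, h0⟩ := hg.exists_zero
  have huniv : ∀ k, k ∈ (Cluster.ofPair g hij).1 := fun k => by
    by_cases hk : k = i
    · exact Or.inl hk
    · refine Or.inr ?_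
      rw [h0]
      exact hg.nonneg _ _ (Ne.symm hk)
  exact ⟨Cluster.ofPair g hij, (hg.height_ofPair hij).trans h0, huniv, fun A k _ => huniv k⟩

/-- The cluster of all elements. -/
noncomputable def top (hg : IsUltraWeight g) : Cluster g := hg.exists_top.choose

theorem height_top (hg : IsUltraWeight g) : hg.top.height = 0 := hg.exists_top.choose_spec.1

theorem mem_top (hg : IsUltraWeight g) (i : X) : i ∈ hg.top.1 := hg.exists_top.choose_spec.2.1 i

theorem le_top (hg : IsUltraWeight g) (A : Cluster g) : A ≤ hg.top :=
  hg.exists_top.choose_spec.2.2 A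

theorem exists_least (hg : IsUltraWeight g) [Finite X] (i : X) :
    ∃ A : Cluster g, i ∈ A.1 ∧ ∀ B : Cluster g, i ∈ B.1 → A ≤ B := by
  obtain ⟨A, hA, hmax⟩ := Set.exists_max_image {A : Cluster g | i ∈ A.1} Cluster.height
    (Set.toFinite _) ⟨hg.top, hg.mem_top i⟩
  exact ⟨A, hA, fun B hB => hg.le_of_height_le hA hB (hmax B hB)⟩

/-- The smallest cluster that contains `i`. -/
noncomputable def least (hg : IsUltraWeight g) [Finite X] (i : X) : Cluster g :=
  (hg.exists_least i).choose

theorem mem_least (hg : IsUltraWeight g) [Finite X] (i : X) :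
    i ∈ (hg.least i).1 := (hg.exists_least i).choose_spec.1

theorem least_le (hg : IsUltraWeight g) [Finite X] {i : X} {A : Cluster g} (h : i ∈ A.1) :
    hg.least i ≤ A :=
  (hg.exists_least i).choose_spec.2 A h

theorem least_le_iff (hg : IsUltraWeight g) [Finite X] {i : X} {A : Cluster g} :
    hg.least i ≤ A ↔ i ∈ A.1 :=
  ⟨fun h => h (hg.mem_least i), hg.least_le⟩

end IsUltraWeight

/-! ### The curve of an ultrametric weight -/

namespace IsUltraWeight

open SimpleGraph

variable {n : ℕ} [NeZero n] {g : Sym2 {i : Fin n // i ≠ 0} → ℝ}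

/-- The cluster that carries a given end. -/
noncomputable def endCluster (hg : IsUltraWeight g) (i : Fin n) : Cluster g :=
  if h : i = 0 then hg.top else hg.least ⟨i, h⟩

theorem endCluster_zero (hg : IsUltraWeight g) : hg.endCluster 0 = hg.top := dif_pos rfl

theorem endCluster_coe (hg : IsUltraWeight g) (i : {i : Fin n // i ≠ 0}) :
    hg.endCluster i = hg.least i := dif_neg i.2

/-- The difference of the heights of two clusters. -/
noncomputable def edgeLength (e : Sym2 (Cluster g)) : ℝ :=
  Sym2.lift ⟨fun A B => |A.height - B.height|, fun _ _ => abs_sub_comm _ _⟩ e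

theorem edgeLength_mk (A B : Cluster g) : edgeLength s(A, B) = |A.height - B.height| := rfl

/-- An element of a cluster is beyond exactly one child of the cluster, or is an end at it. -/
theorem exists_child_or_end (hg : IsUltraWeight g) (A : Cluster g) {k : {i : Fin n // i ≠ 0}}
    (hk : k ∈ A.1) : ∃ t : Cluster g ⊕ Fin n,
      (∃ B, t = Sum.inl B ∧ B ⋖ A ∧ k ∈ B.1) ∨ (t = Sum.inr k.1 ∧ hg.endCluster k = A) := by
  by_cases h : hg.least k = A
  · exact ⟨_, Or.inr ⟨rfl, (hg.endCluster_coe k).trans h⟩⟩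
  · obtain ⟨B, hB, hBA⟩ := exists_le_covBy_of_lt (lt_of_le_of_ne (hg.least_le hk) h)
    exact ⟨_, Or.inl ⟨B, rfl, hBA, hB (hg.mem_least k)⟩⟩

/-- Take a pair `i`, `j` that realises the height of the cluster. The directions towards `i` and
towards `j` differ, as a smaller cluster containing both would be too high. The third direction is
the parent or, at the top, the first end. -/
theorem stable (hg : IsUltraWeight g) (A : Cluster g) :
    3 ≤ ((hasse (Cluster g)).neighborSet A).ncard + {i | hg.endCluster i = A}.ncard := by
  let N : Set (Cluster g ⊕ Fin n) := Sum.inl '' (hasse (Cluster g)).neighborSet A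
  let T : Set (Cluster g ⊕ Fin n) := Sum.inr '' {i | hg.endCluster i = A}
  have hcard : (N ∪ T).ncard =
      ((hasse (Cluster g)).neighborSet A).ncard + {i | hg.endCluster i = A}.ncard := by
    rw [Set.ncard_union_eq _ (Set.toFinite _) (Set.toFinite _),
      Set.ncard_image_of_injective _ Sum.inl_injective,
      Set.ncard_image_of_injective _ Sum.inr_injective]
    rw [Set.disjoint_left]
    rintro _ ⟨B, -, rfl⟩ ⟨i, -, h⟩
    exact Sum.inr_ne_inl h
  rw [← hcard]
  have hmem : ∀ {k : {i : Fin n // i ≠ 0}} {t : Cluster g ⊕ Fin n},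
      ((∃ B, t = Sum.inl B ∧ B ⋖ A ∧ k ∈ B.1) ∨ (t = Sum.inr k.1 ∧ hg.endCluster k = A)) →
      t ∈ N ∪ T := by
    rintro k t (⟨B, rfl, hB, -⟩ | ⟨rfl, h⟩)
    · exact Or.inl ⟨B, Or.inr hB, rfl⟩
    · exact Or.inr ⟨k, h, rfl⟩
  obtain ⟨i, hi, j, hj, hij, hA⟩ := A.exists_pair
  obtain ⟨a, ha⟩ := hg.exists_child_or_end A hi
  obtain ⟨b, hb⟩ := hg.exists_child_or_end A hj
  have hc : ∃ c : Cluster g ⊕ Fin n, c ∈ N ∪ T ∧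
      ((∃ B, c = Sum.inl B ∧ A ⋖ B) ∨ c = Sum.inr 0) := by
    by_cases h : A = hg.top
    · exact ⟨_, Or.inr ⟨0, hg.endCluster_zero.trans h.symm, rfl⟩, Or.inr rfl⟩
    · obtain ⟨B, hB, -⟩ := exists_covBy_le_of_lt (lt_of_le_of_ne (hg.le_top A) h)
      exact ⟨_, Or.inl ⟨B, Or.inl hB, rfl⟩, Or.inl ⟨B, rfl, hB⟩⟩
  obtain ⟨c, hcmem, hc⟩ := hc
  have hne : ∀ {k : {i : Fin n // i ≠ 0}} {t : Cluster g ⊕ Fin n},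
      ((∃ B, t = Sum.inl B ∧ B ⋖ A ∧ k ∈ B.1) ∨ (t = Sum.inr k.1 ∧ hg.endCluster k = A)) →
      t ≠ c := by
    rintro k t (⟨B, rfl, hB, -⟩ | ⟨rfl, -⟩) rfl
    · rcases hc with ⟨B', h1, h2⟩ | h
      · obtain rfl := Sum.inl_injective h1
        exact lt_asymm hB.lt h2.lt
      · exact Sum.inl_ne_inr h
    · rcases hc with ⟨B', h1, h2⟩ | h
      · exact Sum.inr_ne_inl h1
      · exact k.2 (Sum.inr_injective h)
  have hab : a ≠ b := by
    rintro rfl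
    rcases ha with ⟨B, rfl, hB, hiB⟩ | ⟨rfl, -⟩
    · rcases hb with ⟨B', h1, -, hjB⟩ | ⟨h, -⟩
      · obtain rfl := Sum.inl_injective h1
        exact (hg.height_lt hB.lt).not_ge (hA ▸ hg.height_le B hiB hjB hij)
      · exact Sum.inl_ne_inr h
    · rcases hb with ⟨B', h1, -⟩ | ⟨h, -⟩
      · exact Sum.inr_ne_inl h1
      · exact hij (Subtype.ext (Sum.inr_injective h))
  exact (Set.two_lt_ncard_iff (Set.toFinite _)).2
    ⟨a, b, c, hmem ha, hmem hb, hcmem, hab, hne ha, hne hb⟩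

/-- The curve whose vertices are the clusters of an ultrametric weight. -/
noncomputable def curve (hg : IsUltraWeight g) : TropicalCurve n where
  V := Cluster g
  finite := inferInstance
  graph := hasse (Cluster g)
  isTree := isTree_hasse hg.treeOrder hg.le_top
  endAt := hg.endCluster
  stable := hg.stable
  len := edgeLength
  len_pos := by
    intro e he
    induction e with
    | _ A B =>
      rw [edgeLength_mk, abs_pos, sub_ne_zero]
      rcases (he : A ⋖ B ∨ B ⋖ A) with h | h
      · exact (hg.height_lt h.lt).ne'
      · exact (hg.height_lt h.lt).ne

theorem curve_root (hg : IsUltraWeight g) : hg.curve.root = hg.top := hg.endCluster_zero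

/-- Inclusion reverses the order from the root: the root is the cluster of all elements, and the
path to `B` consists of the clusters containing `B`. -/
theorem curve_anc_iff (hg : IsUltraWeight g) (A B : Cluster g) :
    hg.curve.Anc A B ↔ B ≤ A := by
  obtain ⟨p, hp, hsupp⟩ := exists_isPath_hasse hg.treeOrder hg.le_top B
  rw [← hsupp A]
  change A ∈ (hg.curve.path hg.curve.root B).support ↔ _
  have : ∀ (r : Cluster g) (q : (hasse (Cluster g)).Walk r B), q.IsPath → r = hg.top →
      ∀ x, x ∈ q.support ↔ x ∈ p.support := by
    rintro r q hq rfl x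
    have h1 : q = hg.curve.path hg.top B := TropicalCurve.path_eq (C := hg.curve) hq
    have h2 : p = hg.curve.path hg.top B := TropicalCurve.path_eq (C := hg.curve) hp
    rw [h1, h2]
  exact this _ _ (hg.curve.path_isPath _ _) hg.curve_root A

theorem curve_height (hg : IsUltraWeight g) (A : Cluster g) : hg.curve.height A = A.height := by
  have key : ∀ p v : Cluster g, hg.curve.IsParent p v →
      edgeLength s(p, v) = v.height - p.height := fun p v hpv => by
    have hle : v ≤ p := (hg.curve_anc_iff p v).1 hpv.anc
    rw [edgeLength_mk, abs_sub_comm, abs_of_nonneg (sub_nonneg.2 (hg.height_anti hle))]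
  exact TropicalCurve.distOf_root_eq (C := hg.curve) (H := Cluster.height)
    ((congrArg Cluster.height hg.curve_root).trans hg.height_top) key A

/-- The paths to two ends part at the smallest cluster containing both, whose height is the weight
of the pair. So the curve realises the prescribed weight. -/
theorem curve_height_endMeet (hg : IsUltraWeight g) {e : Sym2 {i : Fin n // i ≠ 0}}
    (he : e ∈ (completeMatroid n).E) : hg.curve.height (hg.curve.endMeet e) = g e := by
  induction e with
  | _ i j =>
    have hij := TropicalCurve.ne_of_mem_completeMatroid he
    have hmem : ∀ (k : {i : Fin n // i ≠ 0}) (A : Cluster g),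
        hg.curve.Anc A (hg.curve.endAt k) ↔ k ∈ A.1 := fun k A => by
      rw [← hg.least_le_iff, ← hg.endCluster_coe]
      exact hg.curve_anc_iff _ _
    have : hg.curve.endMeet s(i, j) = Cluster.ofPair g hij := by
      refine TropicalCurve.eq_meet_of_anc (C := hg.curve)
        ((hmem i _).2 (Cluster.left_mem_ofPair hij))
        ((hmem j _).2 (Cluster.right_mem_ofPair hij)) ?_
      refine (hg.curve_anc_iff _ _).2 (hg.ofPair_le hij ?_ ?_)
      · exact (hmem i _).1 (TropicalCurve.meet_anc_left _ _)
      · exact (hmem j _).1 (TropicalCurve.meet_anc_right _ _)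
    rw [this, hg.curve_height]
    exact hg.height_ofPair hij

end IsUltraWeight

/-! ### The linear isomorphism -/

section LinearIso

variable {n : ℕ}

/-- The symmetric function on pairs of marks given by a vector indexed by `i < j`. -/
def symmExt (D : {p : Fin n × Fin n // p.1 < p.2} → ℝ) (i j : Fin n) : ℝ :=
  if h : i < j then D ⟨(i, j), h⟩ else if h : j < i then D ⟨(j, i), h⟩ else 0

theorem symmExt_comm (D : {p : Fin n × Fin n // p.1 < p.2} → ℝ) (i j : Fin n) :
    symmExt D i j = symmExt D j i := by
  rcases lt_trichotomy i j with h | rfl | h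
  · simp [symmExt, h, h.not_gt]
  · rfl
  · simp [symmExt, h, h.not_gt]

theorem symmExt_of_lt (D : {p : Fin n × Fin n // p.1 < p.2} → ℝ) {i j : Fin n} (h : i < j) :
    symmExt D i j = D ⟨(i, j), h⟩ := dif_pos h

theorem symmExt_of_symm {φ : Fin n → Fin n → ℝ} (hφ : ∀ i j, φ i j = φ j i) {i j : Fin n}
    (h : i ≠ j) : symmExt (fun p => φ p.1.1 p.1.2) i j = φ i j := by
  rcases lt_or_gt_of_ne h with h | h
  · exact symmExt_of_lt _ h
  · rw [symmExt_comm, symmExt_of_lt _ h, hφ]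

theorem symmExt_add (D D' : {p : Fin n × Fin n // p.1 < p.2} → ℝ) (i j : Fin n) :
    symmExt (D + D') i j = symmExt D i j + symmExt D' i j := by
  unfold symmExt
  split_ifs <;> simp

theorem symmExt_smul (c : ℝ) (D : {p : Fin n × Fin n // p.1 < p.2} → ℝ) (i j : Fin n) :
    symmExt (c • D) i j = c * symmExt D i j := by
  unfold symmExt
  split_ifs <;> simp

variable [NeZero n]

/-- The negative of the Gromov product with respect to the first mark. -/
noncomputable def negGromov (D : {p : Fin n × Fin n // p.1 < p.2} → ℝ)
    (e : Sym2 {i : Fin n // i ≠ 0}) : ℝ :=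
  Sym2.lift ⟨fun i j : {i : Fin n // i ≠ 0} =>
    (symmExt D i j - symmExt D 0 i - symmExt D 0 j) / 2, fun i j => by
      simp only [symmExt_comm D i j]; ring⟩ e

theorem negGromov_mk (D : {p : Fin n × Fin n // p.1 < p.2} → ℝ) (i j : {i : Fin n // i ≠ 0}) :
    negGromov D s(i, j) = (symmExt D i j - symmExt D 0 i - symmExt D 0 j) / 2 := rfl

theorem negGromov_of_symm {φ : Fin n → Fin n → ℝ} (hφ : ∀ i j, φ i j = φ j i)
    {i j : {i : Fin n // i ≠ 0}} (h : i ≠ j) :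
    negGromov (fun p => φ p.1.1 p.1.2) s(i, j) = (φ i j - φ 0 i - φ 0 j) / 2 := by
  rw [negGromov_mk, symmExt_of_symm hφ fun h' => h (Subtype.ext h'), symmExt_of_symm hφ i.2.symm,
    symmExt_of_symm hφ j.2.symm]

variable (n) in
/-- The map `ℝ^{n choose 2} → ℝ^E / L` that induces the linear isomorphism. -/
noncomputable def gromovMap :
    ({p : Fin n × Fin n // p.1 < p.2} → ℝ) →ₗ[ℝ] (completeMatroid n).BergmanSpace :=
  (completeMatroid n).lineality.mkQ ∘ₗ
    { toFun := fun D e => negGromov D e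
      map_add' := by
        intro D D'
        ext ⟨e, he⟩
        induction e with
        | _ i j => simp only [Pi.add_apply, negGromov_mk, symmExt_add]; ring
      map_smul' := by
        intro c D
        ext ⟨e, he⟩
        induction e with
        | _ i j =>
          simp only [Pi.smul_apply, negGromov_mk, symmExt_smul, smul_eq_mul, RingHom.id_apply]
          ring }

theorem gromovMap_apply (D : {p : Fin n × Fin n // p.1 < p.2} → ℝ) :
    gromovMap n D = (completeMatroid n).lineality.mkQ fun e => negGromov D e := rfl

theorem gromovMap_surjective : Function.Surjective (gromovMap n) := by
  classical
  intro x
  obtain ⟨f, rfl⟩ := (completeMatroid n).lineality.mkQ_surjective x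
  -- With all distances to the first mark equal to `0`, the negative Gromov product is half the
  -- distance.
  let φ : Fin n → Fin n → ℝ := fun i j =>
    if h : (i ≠ 0 ∧ j ≠ 0) ∧ i ≠ j then 2 * f ⟨s(⟨i, h.1.1⟩, ⟨j, h.1.2⟩),
      TropicalCurve.mk_mem_completeMatroid fun h' => h.2 (congrArg Subtype.val h')⟩ else 0
  have hφ : ∀ i j, φ i j = φ j i := by
    intro i j
    by_cases h : (i ≠ 0 ∧ j ≠ 0) ∧ i ≠ j
    · have h' : (j ≠ 0 ∧ i ≠ 0) ∧ j ≠ i := ⟨h.1.symm, h.2.symm⟩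
      simp only [φ, dif_pos h, dif_pos h']
      congr 2
      exact Subtype.ext Sym2.eq_swap
    · have h' : ¬ ((j ≠ 0 ∧ i ≠ 0) ∧ j ≠ i) := fun h' => h ⟨h'.1.symm, h'.2.symm⟩
      simp only [φ, dif_neg h, dif_neg h']
  refine ⟨fun p => φ p.1.1 p.1.2, ?_⟩
  rw [gromovMap_apply]
  congr 1
  ext ⟨e, he⟩
  induction e with
  | _ i j =>
    have hij := TropicalCurve.ne_of_mem_completeMatroid he
    rw [negGromov_of_symm hφ hij]
    have h : ((i : Fin n) ≠ 0 ∧ (j : Fin n) ≠ 0) ∧ (i : Fin n) ≠ j :=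
      ⟨⟨i.2, j.2⟩, fun h' => hij (Subtype.ext h')⟩
    simp [φ, h]

theorem ker_gromovMap : LinearMap.ker (gromovMap n) = LinearMap.range (pairSum n) := by
  refine le_antisymm (fun D hD => ?_) ?_
  · rw [LinearMap.mem_ker, gromovMap_apply, ← map_zero (completeMatroid n).lineality.mkQ] at hD
    obtain ⟨c, hc⟩ := Matroid.mkQ_lineality_eq_iff.1 hD
    -- If the negative Gromov product is constantly `c`, then `d(i,j) = d(1,i) + d(1,j) + 2c`, which
    -- splits as the sum of these values at `i` and `j`.
    refine ⟨fun i => if i = 0 then -c else symmExt D 0 i + c, ?_⟩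
    ext ⟨⟨i, j⟩, hij⟩
    have hij : i < j := hij
    have hj : j ≠ 0 := ((Fin.zero_le i).trans_lt hij).ne'
    change (if i = 0 then -c else symmExt D 0 i + c) + (if j = 0 then -c else symmExt D 0 j + c) = _
    rw [if_neg hj]
    by_cases hi : i = 0
    · subst hi
      rw [if_pos rfl, symmExt_of_lt _ hij]
      ring
    · rw [if_neg hi]
      have := hc ⟨s(⟨i, hi⟩, ⟨j, hj⟩),
        TropicalCurve.mk_mem_completeMatroid fun h' => hij.ne (congrArg Subtype.val h')⟩
      rw [negGromov_mk, symmExt_of_lt _ hij] at this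
      simp only [Pi.zero_apply, zero_add] at this
      linarith
  · rintro _ ⟨x, rfl⟩
    rw [LinearMap.mem_ker, gromovMap_apply, ← map_zero (completeMatroid n).lineality.mkQ,
      Matroid.mkQ_lineality_eq_iff]
    refine ⟨-x 0, fun ⟨e, he⟩ => ?_⟩
    induction e with
    | _ i j =>
      have := negGromov_of_symm (φ := fun i j => x i + x j) (fun i j => add_comm _ _)
        (TropicalCurve.ne_of_mem_completeMatroid he)
      refine this.trans ?_
      simp only [Pi.zero_apply]
      ring

variable (n) in
/-- The linear isomorphism `Q_n → ℝ^E / L`. -/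
noncomputable def gromovEquiv : QSpace n ≃ₗ[ℝ] (completeMatroid n).BergmanSpace :=
  (Submodule.quotEquivOfEq _ _ ker_gromovMap.symm).trans
    ((gromovMap n).quotKerEquivOfSurjective gromovMap_surjective)

theorem gromovEquiv_mkQ (D : {p : Fin n × Fin n // p.1 < p.2} → ℝ) :
    gromovEquiv n ((LinearMap.range (pairSum n)).mkQ D) =
      (completeMatroid n).lineality.mkQ fun e => negGromov D e := rfl

theorem gromovEquiv_splitRay (I : Set {i : Fin n // i ≠ 0}) :
    gromovEquiv n (splitRay (Subtype.val '' I)) =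
      (completeMatroid n).flatRay (cliqueEdges I) := by
  classical
  rw [splitRay, gromovEquiv_mkQ, Matroid.flatRay]
  congr 1
  ext ⟨e, he⟩
  induction e with
  | _ i j =>
    have hij := TropicalCurve.ne_of_mem_completeMatroid he
    have hi : (i : Fin n) ∈ Subtype.val '' I ↔ i ∈ I := Subtype.val_injective.mem_set_image
    have hj : (j : Fin n) ∈ Subtype.val '' I ↔ j ∈ I := Subtype.val_injective.mem_set_image
    have h0 : (0 : Fin n) ∉ Subtype.val '' I := by
      rintro ⟨k, -, hk⟩
      exact k.2 hk
    have hmem : s(i, j) ∈ cliqueEdges I ↔ i ∈ I ∧ j ∈ I := by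
      constructor
      · rintro ⟨a, ha, b, hb, -, h⟩
        rcases Sym2.eq_iff.1 h with ⟨rfl, rfl⟩ | ⟨rfl, rfl⟩
        exacts [⟨ha, hb⟩, ⟨hb, ha⟩]
      · exact fun h => ⟨i, h.1, j, h.2, hij, rfl⟩
    have := negGromov_of_symm (φ := fun i j : Fin n =>
      if i ∈ Subtype.val '' I ↔ j ∈ Subtype.val '' I then (0 : ℝ) else 1)
      (fun i j => by simp only [iff_comm]) hij
    have key : negGromov (fun p : {p : Fin n × Fin n // p.1 < p.2} =>
        if p.1.1 ∈ Subtype.val '' I ↔ p.1.2 ∈ Subtype.val '' I then (0 : ℝ) else 1) s(i, j) =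
        -({x : (completeMatroid n).E | (x : Sym2 _) ∈ cliqueEdges I}.indicator 1
          ⟨s(i, j), he⟩) := by
      rw [this, hi, hj]
      simp only [h0, false_iff, Set.indicator, Set.mem_ofPred_eq, hmem, Pi.one_apply]
      by_cases h1 : i ∈ I <;> by_cases h2 : j ∈ I <;> (simp [h1, h2]; try norm_num)
    convert key using 1
    rfl

end LinearIso

namespace TropicalCurve

variable {n : ℕ} [NeZero n] {C C' : TropicalCurve n}

theorem gromovEquiv_distMap (w : Sym2 C.V → ℝ) : gromovEquiv n (C.distMap w) =
    (completeMatroid n).lineality.mkQ fun e => -C.distOf w C.root (C.endMeet e) := by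
  change gromovEquiv n ((LinearMap.range (pairSum n)).mkQ
    fun p => C.distOf w (C.endAt p.1.1) (C.endAt p.1.2)) = _
  rw [gromovEquiv_mkQ]
  congr 1
  ext ⟨e, he⟩
  induction e with
  | _ i j =>
    rw [negGromov_of_symm (φ := fun i j => C.distOf w (C.endAt i) (C.endAt j))
      (fun i j => C.distOf_comm w _ _) (ne_of_mem_completeMatroid he)]
    have := distOf_eq_meet w (C.endAt i) (C.endAt j)
    change (_ - C.distOf w C.root _ - C.distOf w C.root _) / 2 = _
    rw [this, endMeet_mk]
    ring

theorem gromovEquiv_distVec : gromovEquiv n C.distVec =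
    (completeMatroid n).lineality.mkQ fun e => -C.height (C.endMeet e) := gromovEquiv_distMap C.len

/-! ### The cones of the radially aligned types -/

/-- A weight monotone along the flats of `C` depends only on the meet of a pair, hence is a function
on the vertices that reverses their order. Its negative, shifted to vanish at the root, is the
distance from the root for aligned edge lengths, namely the absolute differences along edges. -/
theorem map_radialCone :
    C.radialCone.map (gromovEquiv n).toLinearMap = (completeMatroid n).flatCone C.levelChain := by
  apply le_antisymm
  · rintro _ ⟨_, ⟨w, hw, rfl⟩, rfl⟩
    change gromovEquiv n (C.distMap w) ∈ _
    rw [gromovEquiv_distMap, Matroid.mkQ_mem_flatCone_iff]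
    exact monotoneAlong_levelFlats.2 fun e e' h => neg_le_neg (hw.2 _ _ h)
  · intro x hx
    obtain ⟨f, rfl⟩ := (completeMatroid n).lineality.mkQ_surjective x
    rw [Matroid.mkQ_mem_flatCone_iff] at hx
    have hf := monotoneAlong_levelFlats.1 hx
    choose r hr using fun v : C.V => exists_endMeet_eq v
    let H : C.V → ℝ := fun v => f (r C.root) - f (r v)
    have hH : ∀ u v, C.height u ≤ C.height v → H u ≤ H v := fun u v h =>
      sub_le_sub_left (hf _ _ (by rw [hr, hr]; exact h)) _
    have hfr : ∀ e : (completeMatroid n).E, f (r (C.endMeet e)) = f e := fun e =>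
      (hf _ _ (by rw [hr])).antisymm (hf _ _ (by rw [hr]))
    let w : Sym2 C.V → ℝ := fun e =>
      Sym2.lift ⟨fun u v => |H u - H v|, fun _ _ => abs_sub_comm _ _⟩ e
    have hw : ∀ v, C.distOf w C.root v = H v := by
      refine distOf_root_eq (sub_self _) fun p v hp => ?_
      change |H p - H v| = _
      rw [abs_sub_comm, abs_of_nonneg (sub_nonneg.2 (hH _ _ hp.height_lt.le))]
    refine ⟨C.distMap w, ⟨w, ⟨fun e _ => ?_, fun u v h => ?_⟩, rfl⟩, ?_⟩
    · induction e with
      | _ u v => exact abs_nonneg (H u - H v)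
    · rw [hw, hw]
      exact hH u v h
    · change gromovEquiv n (C.distMap w) = _
      rw [gromovEquiv_distMap, Matroid.mkQ_lineality_eq_iff]
      refine ⟨-f (r C.root), fun e => ?_⟩
      rw [hw, ← hfr e]
      simp only [H]
      ring

theorem distVec_mem_radialCone_iff : C.distVec ∈ C'.radialCone ↔ C.IsFaceOf C' := by
  rw [← levelFlats_subset_iff_isFaceOf, levelFlats_subset_iff]
  have h1 : C.distVec ∈ C'.radialCone ↔
      gromovEquiv n C.distVec ∈ C'.radialCone.map (gromovEquiv n).toLinearMap := by
    refine ⟨fun h => ⟨_, h, rfl⟩, ?_⟩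
    rintro ⟨x, hx, hxC⟩
    exact (gromovEquiv n).injective hxC ▸ hx
  rw [h1, map_radialCone, gromovEquiv_distVec, Matroid.mkQ_mem_flatCone_iff]
  refine monotoneAlong_levelFlats.trans (forall₂_congr fun e e' => imp_congr_right fun _ => ?_)
  exact neg_le_neg_iff

/-! ### Curves with given weights -/

/-- Subtract the weight from its maximum. The sublevel sets of the weight are flats and thus
transitive, which is the ultrametric inequality for the difference; the pair of maximal weight gets
the value `0`. -/
theorem exists_curve_of_mem_bergmanSet (hn : 3 ≤ n) {f : (completeMatroid n).E → ℝ}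
    (hf : f ∈ (completeMatroid n).bergmanSet) :
    ∃ (C : TropicalCurve n) (c : ℝ), ∀ e : (completeMatroid n).E,
      C.height (C.endMeet e) = c - f e := by
  classical
  have hne : Nonempty (completeMatroid n).E := by
    refine ⟨⟨s(⟨⟨1, by omega⟩, fun h => ?_⟩, ⟨⟨2, by omega⟩, fun h => ?_⟩),
      mk_mem_completeMatroid fun h => ?_⟩⟩
    · simpa using congrArg Fin.val h
    · simpa using congrArg Fin.val h
    · simpa using congrArg Fin.val (congrArg Subtype.val h)
  obtain ⟨⟨e₀, he₀⟩, hmax⟩ := Finite.exists_max f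
  let g : Sym2 {i : Fin n // i ≠ 0} → ℝ := fun e =>
    if h : e ∈ (completeMatroid n).E then f ⟨e₀, he₀⟩ - f ⟨e, h⟩ else 0
  have hg : ∀ e : (completeMatroid n).E, g e = f ⟨e₀, he₀⟩ - f e := fun e => dif_pos e.2
  have hultra : IsUltraWeight g := by
    refine ⟨fun i j k hij hjk hik => ?_, fun i j hij => ?_, ?_⟩
    · have h1 := hg ⟨_, mk_mem_completeMatroid hij⟩
      have h2 := hg ⟨_, mk_mem_completeMatroid hjk⟩
      have h3 := hg ⟨_, mk_mem_completeMatroid hik⟩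
      simp only at h1 h2 h3
      by_contra! hlt
      obtain ⟨h4, h5⟩ := lt_min_iff.1 hlt
      have := (Matroid.cycleMatroid_top_isFlat_iff.1 (Matroid.isFlat_sublevel hf
        (f ⟨_, mk_mem_completeMatroid hik⟩))).2 i j k hik
        ⟨mk_mem_completeMatroid hij, by linarith⟩ ⟨mk_mem_completeMatroid hjk, by linarith⟩
      exact lt_irrefl _ this.2
    · have h1 := hg ⟨_, mk_mem_completeMatroid hij⟩
      simp only at h1
      rw [h1]
      exact sub_nonneg.2 (hmax _)
    · have h1 := hg ⟨e₀, he₀⟩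
      induction e₀ with
      | _ i j => exact ⟨i, j, ne_of_mem_completeMatroid he₀, h1.trans (sub_self _)⟩
  exact ⟨hultra.curve, f ⟨e₀, he₀⟩, fun e => (hultra.curve_height_endMeet e.2).trans (hg e)⟩

/-! ### Radially aligned types and chains of flats -/

/-- A weight in the relative interior of the cone is realised by a curve. Its flats induce the same
preorder on pairs as the given chain, and a chain is determined by its preorder. -/
theorem levelChain_surjective (hn : 3 ≤ n) :
    Function.Surjective (levelChain : TropicalCurve n → (completeMatroid n).ChainOfFlats) := by
  intro S
  obtain ⟨f, hf⟩ := S.exists_strictly_monotoneAlong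
  have hmono : (completeMatroid n).MonotoneAlong S.1 f := fun e e' h => (hf e e').1 h
  obtain ⟨C, c, hC⟩ :=
    exists_curve_of_mem_bergmanSet hn (Matroid.mem_bergmanSet_of_monotoneAlong hmono)
  have key : ∀ e e' : (completeMatroid n).E,
      (∀ F ∈ C.levelFlats, (e' : Sym2 {i : Fin n // i ≠ 0}) ∈ F → (e : Sym2 _) ∈ F) ↔
        ∀ F ∈ S.1, (e' : Sym2 {i : Fin n // i ≠ 0}) ∈ F → (e : Sym2 _) ∈ F := by
    intro e e'
    rw [forall_mem_levelFlats_iff, hf, hC, hC]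
    exact sub_le_sub_iff_left c
  refine ⟨C, Subtype.ext (Set.Subset.antisymm ?_ ?_)⟩
  · exact Matroid.ChainOfFlats.subset_of_forall (S := C.levelChain) fun e e' => (key e e').2
  · exact Matroid.ChainOfFlats.subset_of_forall (T := C.levelChain) fun e e' => (key e e').1

theorem levelChain_eq_iff : C.levelChain = C'.levelChain ↔ C.SameRadialType C' := by
  rw [sameRadialType_iff]
  exact ⟨fun h => congrArg Subtype.val h, fun h => Subtype.ext h⟩

/-- The bijection between the radially aligned types and the chains of flats. -/
noncomputable def typeEquiv (hn : 3 ≤ n) : RadialType n ≃ (completeMatroid n).ChainOfFlats :=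
  Equiv.ofBijective
    (Quotient.lift (s := radialSetoid n) levelChain fun _ _ h => levelChain_eq_iff.2 h) <| by
    constructor
    · intro x y
      induction x using Quotient.inductionOn with
      | _ C =>
      induction y using Quotient.inductionOn with
      | _ C' => exact fun h => Quotient.sound (s := radialSetoid n) (levelChain_eq_iff.1 h)
    · intro S
      obtain ⟨C, hC⟩ := levelChain_surjective hn S
      exact ⟨C.radialType, hC⟩

theorem typeEquiv_radialType (hn : 3 ≤ n) (C : TropicalCurve n) :
    typeEquiv hn C.radialType = C.levelChain := rfl

theorem bijOn_bergmanSet' (hn : 3 ≤ n) :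
    Set.BijOn (fun x : MRad n => gromovEquiv n x.embed) Set.univ
      (completeMatroid n).bergmanSet' := by
  refine ⟨fun x _ => ?_, fun x _ y _ => ?_, fun x hx => ?_⟩
  · induction x using Quotient.inductionOn with
    | _ C =>
      change gromovEquiv n C.distVec ∈ _
      rw [gromovEquiv_distVec, Matroid.mkQ_mem_bergmanSet'_iff]
      exact Matroid.mem_bergmanSet_of_monotoneAlong (S := C.levelChain) monotoneAlong_neg_height
  · induction x using Quotient.inductionOn with
    | _ C =>
    induction y using Quotient.inductionOn with
    | _ C' =>
      intro h
      change gromovEquiv n C.distVec = gromovEquiv n C'.distVec at h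
      rw [gromovEquiv_distVec, gromovEquiv_distVec, Matroid.mkQ_lineality_eq_iff] at h
      obtain ⟨c, hc⟩ := h
      -- Heights are nonnegative, and in each curve some pair parts at height `0`; so the constant
      -- by which the weights may differ is `0`.
      obtain ⟨e, he⟩ := exists_endMeet_eq C.root
      obtain ⟨e', he'⟩ := exists_endMeet_eq C'.root
      have h1 := hc e
      have h2 := hc e'
      rw [he, height_root] at h1
      rw [he', height_root] at h2
      have h3 := height_nonneg (C'.endMeet e)
      have h4 := height_nonneg (C.endMeet e')
      have hc0 : c = 0 := by linarith
      exact Quotient.sound (isom_of_height_eq fun e => by have := hc e; linarith)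
  · obtain ⟨f, hf, rfl⟩ := hx
    obtain ⟨C, c, hC⟩ := exists_curve_of_mem_bergmanSet hn hf
    refine ⟨Quotient.mk _ C, Set.mem_univ _, ?_⟩
    change gromovEquiv n C.distVec = _
    rw [gromovEquiv_distVec, Matroid.mkQ_lineality_eq_iff]
    exact ⟨-c, fun e => by rw [hC]; ring⟩

theorem image_radialFan (hn : 3 ≤ n) :
    (fun σ : PointedCone ℝ (QSpace n) => σ.map (gromovEquiv n).toLinearMap) '' radialFan n =
      (completeMatroid n).bergmanFan := by
  have h : (fun C : TropicalCurve n => C.radialCone.map (gromovEquiv n).toLinearMap) =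
      (completeMatroid n).flatCone ∘ levelChain := funext fun C => map_radialCone
  rw [radialFan, ← Set.range_comp, Matroid.bergmanFan]
  exact (congrArg Set.range h).trans ((levelChain_surjective hn).range_comp _)

end TropicalCurve

/-! ### The comparison theorem -/

theorem mainTheorem2 (n : ℕ) [NeZero n] (hn : 3 ≤ n) :
    -- the two collections of cones are polyhedral fans, and the second one subdivides `B'`
    IsPolyhedralFan (radialFan n) ∧
    IsPolyhedralFan (completeMatroid n).bergmanFan ∧
    (⋃ σ ∈ (completeMatroid n).bergmanFan, (σ : Set (completeMatroid n).BergmanSpace)) =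
      (completeMatroid n).bergmanSet' ∧
    ∃ (Ψ : (completeMatroid n).ChainOfFlats ≃ RadialType n)
      (L : QSpace n ≃ₗ[ℝ] (completeMatroid n).BergmanSpace),
      -- the bijection of the cones is the one given by the levels of a curve
      (∀ C : TropicalCurve n, (Ψ.symm C.radialType).1 = C.levelFlats) ∧
      -- it respects the face relations
      (∀ C C' : TropicalCurve n,
        (Ψ.symm C.radialType).1 ⊆ (Ψ.symm C'.radialType).1 ↔ C.IsFaceOf C') ∧
      -- a curve lies in exactly those cones of which its type is a face
      (∀ C C' : TropicalCurve n, C.distVec ∈ C'.radialCone ↔ C.IsFaceOf C') ∧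
      -- the linear isomorphism sends the ray of a split to the ray of the complete graph
      (∀ I : Set {i : Fin n // i ≠ 0}, I.Nontrivial → I ≠ Set.univ →
        L (splitRay (Subtype.val '' I)) = (completeMatroid n).flatRay (cliqueEdges I)) ∧
      -- it identifies the moduli space with `B'` as sets, cone by cone, and as fans
      Set.BijOn (fun x : MRad n => L x.embed) Set.univ (completeMatroid n).bergmanSet' ∧
      (∀ (S : (completeMatroid n).ChainOfFlats) (C : TropicalCurve n), C.radialType = Ψ S →
        C.radialCone.map L.toLinearMap = (completeMatroid n).flatCone S) ∧
      (fun σ : PointedCone ℝ (QSpace n) => σ.map L.toLinearMap) '' radialFan n =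
        (completeMatroid n).bergmanFan := by
  have hfan := (completeMatroid n).isPolyhedralFan_bergmanFan
  refine ⟨.of_image_map (gromovEquiv n) (TropicalCurve.image_radialFan hn ▸ hfan), hfan,
    Matroid.iUnion_bergmanFan, (TropicalCurve.typeEquiv hn).symm, gromovEquiv n, fun C => rfl,
    fun C C' => TropicalCurve.levelFlats_subset_iff_isFaceOf,
    fun C C' => TropicalCurve.distVec_mem_radialCone_iff, fun I _ _ => gromovEquiv_splitRay I,
    TropicalCurve.bijOn_bergmanSet' hn, fun S C hC => ?_, TropicalCurve.image_radialFan hn⟩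
  rw [TropicalCurve.map_radialCone, ← TropicalCurve.typeEquiv_radialType hn, hC,
    Equiv.apply_symm_apply]
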